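/- Let $F_0=0$, $F_1=1$, $F_i=F_{i-1}+F_{i-2}$. Every integer $n\ge 0$ has a unique Zeckendorf representation $(n)_F=a_t a_{t-1}\cdots a_2\in\{0,1\}^*$ with $n=\sum_{2\le i\le t}a_iF_i$, no two consecutive $1$'s and no leading zero (it is the empty word for $n=0$); $|(n)_F|=t-1$ denotes its length. Let $f=(f(i))_{i\ge 0}=01001010\cdots$ be the Fibonacci word, where $f(i)$ is the last digit $a_2$ of $(i)_F$ (and $f(0)=0$); equivalently, $f$ is the fixed point of $0\mapsto 01$, $1\mapsto 0$. An lsd-first DFAO generating a sequence $(a(i))_{i\ge 0}$ is a deterministic finite automaton with output, with input alphabet $\{0,1\}$ and partial transition function, such that every word $x_0x_1\cdots x_{\ell-1}\in\{0,1\}^*$ without two consecutive $1$'s (trailing zeros being allowed) leads from the initial state to a state with output $a\bigl(\sum_{j} x_jF_{j+2}\bigr)$, while a word with two consecutive $1$'s does not reach any state. For every $c\ge 5$, the minimum number of states of an lsd-first DFAO generating $(f(i+c))_{i\ge 0}$ is exactly $$2\bigl(|(c)_F|+1\bigr)+1-g(c),$$ where $g(c)=1$ if $f(c-1)=f(c-2)=0$,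 and $g(c)=0$ otherwise. Consequently, for every $c\ge 0$ let $s(c)$ be the minimum number of states of an lsd-first DFAO generating $(f(i+c))_{i\ge 0}$ (such a DFAO exists for every $c$). Then $s$ is Fibonacci-regular: there are $d\ge 0$, a row vector $v\in\mathbb N^{d}$, matrices $\gamma(0),\gamma(1)\in\mathbb N^{d\times d}$ and a column vector $w\in\mathbb N^{d}$ such that $s(n)=v\,\gamma(a_t)\cdots\gamma(a_2)\,w$ for all $n\ge 0$, where $(n)_F=a_t\cdots a_2$. Moreover $s(c)=\Theta(\log c)$ as $c\to\infty$; that is, the upper bound $O(\log c)$ on the lsd-first state complexity of $(f(i+c))_{i\ge 0}$ is optimal. -/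

import Mathlib

open scoped Matrix
open Asymptotics Filter

/-- The canonical Zeckendorf representation `(n)_F = a_t ⋯ a_2` of `n`, most significant digit
first and without leading zeros (so the empty word for `n = 0`); `a_i = 1` iff `F_i` occurs in the
Zeckendorf decomposition of `n`, and `t` is the largest index that occurs. -/
def fibRep (n : ℕ) : List (Fin 2) :=
  (List.range (n.greatestFib - 1)).reverse.map fun j => if j + 2 ∈ n.zeckendorf then 1 else 0

/-- The Fibonacci word `f = 01001010⋯`: `f(i)` is the last digit of the Zeckendorf representation
of `i` (and `f(0) = 0`). -/
def fibWord (i : ℕ) : Fin 2 := (fibRep i).getLastD 0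

/-- A word over `{0,1}` is a valid Zeckendorf word if it has no two consecutive `1`s. Leading and
trailing zeros are allowed. -/
def IsValidZeckendorf (x : List (Fin 2)) : Prop := x.IsChain fun a b => ¬(a = 1 ∧ b = 1)

/-- The integer denoted by a word read least significant digit first: the digit in position `i`
(counted from `0`) has weight `F_{i+2}`. -/
def lsdVal (x : List (Fin 2)) : ℕ := ∑ i : Fin x.length, (x.get i : ℕ) * Nat.fib (i + 2)

/-- A deterministic automaton with output, with state set `Q`, input alphabet `A` and output
alphabet `Δ`. The transition function is partial, so that invalid inputs may reach no state. -/
structure DFAO (Q A Δ : Type*) where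
  /-- transition function; `none` means that there is no transition -/
  δ : Q → A → Option Q
  /-- initial state -/
  q₀ : Q
  /-- output function -/
  τ : Q → Δ

/-- The state reached on input `x`, if any. -/
def DFAO.run {Q A Δ : Type*} (M : DFAO Q A Δ) (x : List A) : Option Q := x.foldlM M.δ M.q₀

/-- `M` generates the sequence `a` with least-significant-digit-first Zeckendorf input: on every
valid word (whatever the number of trailing zeros, i.e. zeros in the most significant positions)
a state is reached whose output is the term of `a` indexed by the value of the word, and an
invalid word does not reach any state. -/
def DFAO.GeneratesLsd {Q Δ : Type*} (M : DFAO Q (Fin 2) Δ) (a : ℕ → Δ) : Prop :=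
  ∀ x : List (Fin 2),
    (IsValidZeckendorf x → ∃ q, M.run x = some q ∧ M.τ q = a (lsdVal x)) ∧
    (¬ IsValidZeckendorf x → M.run x = none)

/-- The numbers of states of the (finite) lsd-first DFAOs generating `a`. -/
def lsdStateCounts {Δ : Type*} (a : ℕ → Δ) : Set ℕ :=
  {n | ∃ (Q : Type) (_ : Fintype Q) (M : DFAO Q (Fin 2) Δ), M.GeneratesLsd a ∧ Fintype.card Q = n}

/-- The lsd-first state complexity of `a`: the number of states of a minimal lsd-first DFAO
generating `a` (meaningful if there is such a DFAO). -/
noncomputable def lsdStateComplexity {Δ : Type*} (a : ℕ → Δ) : ℕ := sInf (lsdStateCounts a)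

/-- The correction term `g(c)`, for `c ≥ 2`. -/
def gCorr (c : ℕ) : ℕ := if fibWord (c - 1) = 0 ∧ fibWord (c - 2) = 0 then 1 else 0

/-- A sequence over a semiring `R` is Fibonacci-regular over `R` if it has a linear representation
`s(n) = v γ(a_t) ⋯ γ(a_2) w`, where `a_t ⋯ a_2` is the Zeckendorf representation of `n`. -/
def IsFibonacciRegular {R : Type*} [Semiring R] (s : ℕ → R) : Prop :=
  ∃ (d : ℕ) (v : Fin d → R) (γ : Fin 2 → Matrix (Fin d) (Fin d) R) (w : Fin d → R),
    ∀ n, s n = v ⬝ᵥ (((fibRep n).map γ).prod *ᵥ w)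

/-! The function `hofG`, i.e. `⌊(n+1)/φ⌋`, shifts Zeckendorf digits to the right (rounding up), and
the lowest digit of `n` is `1` exactly when `hofG` does not jump from `n` to `n + 1`. On a sum,
`hofG (n + u + 1)` exceeds `hofG n + hofG u` by one bit, `carry u n`, which says whether the
fractional parts of `(n+1)/φ` and `(u+1)/φ` add up to at least `1`. Hence `f(n + c + 1)` is a
constant xor `carry c n` xor `carry (c + 1) n` (`lowDigit_add`).

Each carry is a digit comparison (`carry_succ`): the lowest digit `a` of `n` is compared with the
digit prescribed by `u`. If they differ, the carry is settled as `!a`; if they agree, it is the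
negation of a carry for the remaining digits of `n`, with `u + 1` replaced by `hofG u`. So an
lsd-first automaton need only remember the last digit, the pending carries and the parity of what is
settled: this is `ShiftState`.

Minimality is a Myhill–Nerode argument. States without redundancy (`Good`) are separated by some
continuation (`eq_of_behaviour_eq`), so a finite closed set of reachable good states that contains
the initial one has the minimal size (`isLeast_lsdStateCounts`).

For the count, there are four settled states. Once the two carries have separated, each pending one
runs down the chain `u + 1 ↦ hofG u`, the two chains carry opposite parities, and one step of the
chain costs one Zeckendorf digit (`length_fibRep_add_two`), so together they have `2 * (fibRep (u +
1)).length` states (`IsPair.card_union`). If both carries prescribe the same first digit, one extra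
state with two pending carries appears but the chains lose two states in all: this is the correction
`gCorr`.

The resulting formula is twice a digit counter plus a function of a finite msd-first automaton, with
a table for `c < 5`, which gives regularity; the length of the representation is comparable to `log
c`. -/

/-! ### Zeckendorf digits through the floor function `⌊(n+1)/φ⌋` -/

/-- The Hofstadter function `n ↦ ⌊(n + 1) / φ⌋`, which shifts Zeckendorf digits to the right. -/
noncomputable def hofG (n : ℕ) : ℕ := ⌊((n : ℝ) + 1) * (Real.goldenRatio - 1)⌋₊

/-- The left shift of Zeckendorf digits. -/
noncomputable def zshift (n : ℕ) : ℕ := n + hofG n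

/-- The lowest Zeckendorf digit of `n`. -/
noncomputable def lowDigit (n : ℕ) : Bool := decide (hofG (n + 1) = hofG n)

/-- The carry bit of the function `hofG` for the sum `n + (u + 1)`. -/
noncomputable def carry (u n : ℕ) : Bool := decide (hofG (n + u + 1) = hofG n + hofG u + 1)

lemma hofG_le (n : ℕ) : (hofG n : ℝ) ≤ ((n : ℝ) + 1) * (Real.goldenRatio - 1) :=
  Nat.floor_le (mul_nonneg (by positivity) (by linarith [Real.one_lt_goldenRatio]))

lemma hofG_lt (n : ℕ) : (hofG n : ℝ) < ((n : ℝ) + 1) * (Real.goldenRatio - 1) := by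
  refine (hofG_le n).lt_of_ne fun h => ?_
  have h1 : Irrational (((n + 1 : ℕ) : ℝ) * (Real.goldenRatio - ((1 : ℕ) : ℝ))) :=
    (Real.goldenRatio_irrational.sub_natCast 1).natCast_mul (Nat.succ_ne_zero n)
  push_cast at h1
  rw [← h] at h1
  exact Nat.not_irrational _ h1

lemma lt_hofG (n : ℕ) : ((n : ℝ) + 1) * (Real.goldenRatio - 1) < hofG n + 1 :=
  Nat.lt_floor_add_one _

lemma hofG_eq_of {n k : ℕ} (h1 : (k : ℝ) ≤ ((n : ℝ) + 1) * (Real.goldenRatio - 1))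
    (h2 : ((n : ℝ) + 1) * (Real.goldenRatio - 1) < k + 1) : hofG n = k := by
  have h3 := hofG_le n
  have h4 := lt_hofG n
  have h5 : (hofG n : ℝ) < (k + 1 : ℕ) := by push_cast; linarith
  have h6 : (k : ℝ) < (hofG n + 1 : ℕ) := by push_cast; linarith
  rw [Nat.cast_lt] at h5 h6
  omega

lemma hofG_add (u n : ℕ) :
    hofG (n + u + 1) = hofG n + hofG u ∨ hofG (n + u + 1) = hofG n + hofG u + 1 := by
  have h1 := hofG_le n
  have h2 := hofG_le u
  have h3 := hofG_le (n + u + 1)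
  have h4 := lt_hofG n
  have h5 := lt_hofG u
  have h6 := lt_hofG (n + u + 1)
  push_cast at h3 h6
  have h7 : (hofG n + hofG u : ℝ) < (hofG (n + u + 1) + 1 : ℝ) := by linarith
  have h8 : (hofG (n + u + 1) : ℝ) < hofG n + hofG u + 2 := by linarith
  norm_cast at h7 h8
  omega

lemma goldenRatio_gt : (1.6 : ℝ) < Real.goldenRatio := by
  have h := Real.goldenRatio_sq
  have h2 := Real.one_lt_goldenRatio
  nlinarith

@[simp] lemma hofG_zero : hofG 0 = 0 := by
  apply hofG_eq_of <;> push_cast <;> linarith [Real.one_lt_goldenRatio, Real.goldenRatio_lt_two]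

lemma hofG_succ (n : ℕ) : hofG (n + 1) = hofG n ∨ hofG (n + 1) = hofG n + 1 := by
  simpa using hofG_add 0 n

lemma hofG_mono : Monotone hofG :=
  monotone_nat_of_le_succ fun n => by have := hofG_succ n; omega

lemma hofG_lt_add_two (n : ℕ) : hofG n < hofG (n + 2) := by
  have h1 := hofG_le n
  have h2 := lt_hofG (n + 2)
  push_cast at h2
  have h3 : (hofG n : ℝ) < hofG (n + 2) := by
    have := goldenRatio_gt
    nlinarith
  exact_mod_cast h3

/-- Since `φ(φ − 1) = 1`, the number `(n+1) + (n+1)(φ−1)` times `φ − 1` is exactly `n + 1`. Taking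
the floor of the second summand lowers the product by a positive amount (irrationality) less than `φ
− 1 < 1`, so its floor is `n`. -/
lemma hofG_zshift (n : ℕ) : hofG (zshift n) = n := by
  have h1 := hofG_lt n
  have h2 := lt_hofG n
  have h := Real.goldenRatio_sq
  have h3 := Real.one_lt_goldenRatio
  have h4 := Real.goldenRatio_lt_two
  apply hofG_eq_of <;> simp only [zshift] <;> push_cast <;>
  nlinarith [mul_lt_mul_of_pos_right h1 (by linarith : 0 < Real.goldenRatio - 1),
    mul_lt_mul_of_pos_right h2 (by linarith : 0 < Real.goldenRatio - 1)]

lemma hofG_zshift_succ (n : ℕ) : hofG (zshift n + 1) = n + 1 := by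
  have h1 := hofG_le n
  have h2 := lt_hofG n
  have h := Real.goldenRatio_sq
  have h3 := Real.one_lt_goldenRatio
  have h4 := Real.goldenRatio_lt_two
  apply hofG_eq_of <;> simp only [zshift] <;> push_cast <;>
  nlinarith [mul_le_mul_of_nonneg_right h1 (by linarith : 0 ≤ Real.goldenRatio - 1),
    mul_lt_mul_of_pos_right h2 (by linarith : 0 < Real.goldenRatio - 1)]

lemma lowDigit_eq_true {n : ℕ} : lowDigit n = true ↔ hofG (n + 1) = hofG n := by
  simp [lowDigit]

lemma lowDigit_eq_false {n : ℕ} : lowDigit n = false ↔ hofG (n + 1) = hofG n + 1 := by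
  have := hofG_succ n
  simp only [lowDigit, decide_eq_false_iff_not]
  omega

lemma hofG_succ_eq (n : ℕ) : hofG (n + 1) + (lowDigit n).toNat = hofG n + 1 := by
  cases h : lowDigit n
  · simp [lowDigit_eq_false.1 h]
  · simp [lowDigit_eq_true.1 h]

lemma hofG_add_eq (u n : ℕ) : hofG (n + u + 1) = hofG n + hofG u + (carry u n).toNat := by
  have := hofG_add u n
  unfold carry
  by_cases h : hofG (n + u + 1) = hofG n + hofG u + 1
  · simp [h]
  · simp [h]; omega

lemma zshift_succ (n : ℕ) : zshift (n + 1) + (lowDigit n).toNat = zshift n + 2 := by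
  have := hofG_succ_eq n
  simp only [zshift]; omega

@[simp] lemma zshift_zero : zshift 0 = 0 := by simp [zshift]

@[simp] lemma lowDigit_zshift (n : ℕ) : lowDigit (zshift n) = false :=
  lowDigit_eq_false.2 (by rw [hofG_zshift, hofG_zshift_succ])

/-- Adding `1` to a shifted number writes a digit `1` if the neighbouring digit is `0`; otherwise
the result is the shift of `n + 1` and ends in `0`. -/
lemma lowDigit_zshift_succ (n : ℕ) : lowDigit (zshift n + 1) = !lowDigit n := by
  have h := zshift_succ n
  cases hd : lowDigit n
  · rw [hd] at h
    have h' : zshift n + 1 + 1 = zshift (n + 1) := by simpa using h.symm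
    simp only [Bool.not_false]
    rw [lowDigit_eq_true, h', hofG_zshift, hofG_zshift_succ]
  · rw [hd] at h
    have h' : zshift n + 1 = zshift (n + 1) := by simpa using h.symm
    rw [h']; simp

@[simp] lemma lowDigit_zero : lowDigit 0 = false := by simpa using lowDigit_zshift 0

lemma lowDigit_succ_of_true {n : ℕ} (h : lowDigit n = true) : lowDigit (n + 1) = false := by
  have h1 := hofG_lt_add_two n
  rw [lowDigit_eq_true] at h
  have h2 := hofG_succ (n + 1)
  rw [lowDigit_eq_false]
  rw [show n + 2 = n + 1 + 1 from rfl] at h1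
  omega

/-- Every natural number is a left shift plus an admissible digit. -/
lemma exists_zshift (n : ℕ) :
    ∃ m, n = zshift m + (lowDigit n).toNat ∧ (lowDigit n = true → lowDigit m = false) := by
  have key : ∀ n, ∃ m, ∃ a : Bool, n = zshift m + a.toNat ∧ (a = true → lowDigit m = false) := by
    intro n
    induction n with
    | zero => exact ⟨0, false, by simp, by simp⟩
    | succ n ih =>
      obtain ⟨m, a, h1, h2⟩ := ih
      have h3 := zshift_succ m
      cases a
      · cases hm : lowDigit m
        · exact ⟨m, true, by simp [h1], fun _ => hm⟩
        · exact ⟨m + 1, false, by simp [hm] at h3 h1 ⊢; omega, by simp⟩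
      · have hm := h2 rfl
        exact ⟨m + 1, false, by simp [hm] at h3 h1 ⊢; omega, by simp⟩
  obtain ⟨m, a, h1, h2⟩ := key n
  cases a
  · have : lowDigit n = false := by rw [h1]; simp
    exact ⟨m, by simpa [this] using h1, by simp [this]⟩
  · have : lowDigit n = true := by rw [h1]; simp [lowDigit_zshift_succ, h2]
    exact ⟨m, by simpa [this] using h1, fun _ => h2 rfl⟩

lemma lowDigit_zshift_add {m : ℕ} {a : Bool} (h : a = true → lowDigit m = false) :
    lowDigit (zshift m + a.toNat) = a := by
  cases a
  · simp
  · simp [lowDigit_zshift_succ, h]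

lemma hofG_zshift_add (m : ℕ) (a : Bool) : hofG (zshift m + a.toNat) = m + a.toNat := by
  cases a
  · simpa using hofG_zshift m
  · simpa using hofG_zshift_succ m

/-! ### Carries and their digit recursion -/

lemma carry_comm (u n : ℕ) : carry u n = carry n u := by
  simp only [carry, Nat.add_comm n u, Nat.add_comm (hofG n)]

lemma carry_zero_right (u : ℕ) : carry u 0 = !lowDigit u := by
  have h1 := hofG_add_eq u 0
  have h2 := hofG_succ_eq u
  simp only [Nat.zero_add, hofG_zero] at h1
  cases h3 : carry u 0 <;> cases h4 : lowDigit u <;> simp [h3, h4] at h1 h2 ⊢ <;> omega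

lemma carry_zero_left (n : ℕ) : carry 0 n = !lowDigit n := by
  rw [carry_comm, carry_zero_right]

/-- The low digit measures the increment of `hofG`. Expanding both values at `n + c + 1` and `n + c
+ 2` cancels `hofG n` and leaves the increment at `c` plus the difference of two carries, which
modulo 2 is their xor. -/
lemma lowDigit_add (c n : ℕ) :
    lowDigit (n + c + 1) = (lowDigit c ^^ carry c n ^^ carry (c + 1) n) := by
  have h1 := hofG_add_eq c n
  have h2 := hofG_add_eq (c + 1) n
  have h3 := hofG_succ_eq (n + c + 1)
  have h4 := hofG_succ_eq c
  rw [← Nat.add_assoc] at h2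
  cases h5 : carry c n <;> cases h6 : carry (c + 1) n <;> cases h7 : lowDigit c <;>
    cases h8 : lowDigit (n + c + 1) <;> simp [h5, h6, h7, h8] at h1 h2 h3 h4 ⊢ <;> omega

/-- A carry is forced if a digit `1` appears next to a digit `0`. -/
lemma carry_of_lowDigit {q m : ℕ} (h : lowDigit m = false) (hr : lowDigit (m + q + 1) = true) :
    carry q m = true := by
  have h1 := hofG_add_eq q m
  have h2 := hofG_add_eq q (m + 1)
  rw [lowDigit_eq_true] at hr
  rw [lowDigit_eq_false] at h
  rw [show m + 1 + q + 1 = m + q + 1 + 1 by omega] at h2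
  cases h3 : carry q m
  · simp [h3] at h1; omega
  · rfl

/-- Digit-by-digit recursion for the carry. -/
lemma carry_succ (u m : ℕ) (a : Bool) (ha : a = true → lowDigit m = false) :
    carry (u + 1) (zshift m + a.toNat) = if a = lowDigit u then !carry (hofG u) m else !a := by
  obtain ⟨q, hq, hb⟩ := exists_zshift u
  set b := lowDigit u
  have h1 := hofG_add_eq (u + 1) (zshift m + a.toNat)
  have hE := hofG_add_eq q m
  -- The carry of the shorter numbers is exactly the defect from additivity of the left shift.
  have hz : zshift m + zshift q + 1 + (carry q m).toNat = zshift (m + q + 1) := by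
    simp only [zshift]; omega
  set r := m + q + 1 with hr
  have hr0 := hofG_zshift r
  have hr1 := hofG_zshift_succ r
  have hr2 := hofG_succ_eq (zshift r + 1)
  have hr3 := hofG_succ_eq (zshift r + 1 + 1)
  have hd := lowDigit_zshift_succ r
  have hd2 := @lowDigit_succ_of_true (zshift r + 1)
  have hu : hofG u = q + b.toNat := by rw [hq]; exact hofG_zshift_add q b
  have hu1 := hofG_succ_eq u
  have hn := hofG_zshift_add m a
  have hf1 : (lowDigit r).toNat ≤ (carry q m).toNat + (lowDigit m).toNat := by
    have := @carry_of_lowDigit q m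
    cases h1 : lowDigit r <;> cases h2 : lowDigit m <;> simp_all
  have hf2 : (lowDigit r).toNat ≤ (carry q m).toNat + (lowDigit q).toNat := by
    have := @carry_of_lowDigit m q
    rw [carry_comm m q, show q + m + 1 = r by omega] at this
    cases h1 : lowDigit r <;> cases h2 : lowDigit q <;> simp_all
  have hd3 : (lowDigit (zshift r + 1 + 1)).toNat ≤ (lowDigit r).toNat := by
    rw [hd] at hd2
    cases h1 : lowDigit r <;> simp_all [Bool.toNat_le]
  have hd4 : (lowDigit (zshift r + 1)).toNat + (lowDigit r).toNat = 1 := by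
    rw [hd]; cases lowDigit r <;> rfl
  have ha' : a.toNat + (lowDigit m).toNat ≤ 1 := by
    cases a
    · simpa using Bool.toNat_le _
    · simp [ha]
  have hb' : b.toNat + (lowDigit q).toNat ≤ 1 := by
    cases hbb : b
    · simpa using Bool.toNat_le _
    · simp [hb hbb]
  have hc1 := hofG_add_eq (q + 1) m
  have hq1 := hofG_succ_eq q
  have hrr := hofG_succ_eq r
  rw [show m + (q + 1) + 1 = r + 1 by omega] at hc1
  have hidx : zshift m + a.toNat + (u + 1) + 1 + (carry q m).toNat
      = zshift r + 1 + a.toNat + b.toNat := by omega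
  change hofG (u + 1) + b.toNat = _ at hu1
  rw [hn] at h1
  rw [hu] at hu1
  -- The argument `N` is one of the four integers `zshift r`, …, `zshift r + 3`, where the values of
  -- `hofG` are known from `r` and the low digits, so the cases are finitely many.
  have hc : (carry (u + 1) (zshift m + a.toNat)).toNat
      = if a = b then 1 - (carry (q + b.toNat) m).toNat else 1 - a.toNat := by
    clear hq hz hn
    generalize zshift m + a.toNat + (u + 1) + 1 = N at *
    generalize (carry (u + 1) (zshift m + a.toNat)).toNat = e at *
    clear_value b
    have := Bool.toNat_le (lowDigit r)
    have := Bool.toNat_le (carry (q + 1) m)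
    cases a <;> cases b <;> cases hx : carry q m <;>
      simp only [hx, Bool.toNat_true, Bool.toNat_false, Nat.add_zero, reduceIte,
        reduceCtorEq] at * <;>
      first
        | (have hN : N = zshift r := by omega); rw [hN] at h1; omega
        | (have hN : N = zshift r + 1 := by omega); rw [hN] at h1; omega
        | (have hN : N = zshift r + 1 + 1 := by omega); rw [hN] at h1; omega
        | (have hN : N = zshift r + 1 + 1 + 1 := by omega); rw [hN] at h1; omega
  rw [hu]
  revert hc
  cases carry (u + 1) (zshift m + a.toNat) <;> cases carry (q + b.toNat) m <;> cases a <;>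
    cases b <;> simp

/-! ### Words, their values and the shift -/

/-- A binary digit as a Boolean. -/
def bit (a : Fin 2) : Bool := a == 1

lemma bit_toNat (a : Fin 2) : (bit a).toNat = a := by
  fin_cases a <;> rfl

lemma bit_eq_true {a : Fin 2} : bit a = true ↔ a = 1 := by
  fin_cases a <;> simp [bit]

lemma bit_inj {a b : Fin 2} : bit a = bit b ↔ a = b := by
  revert a b; decide

/-- A Boolean as a binary digit. -/
def ofBit (b : Bool) : Fin 2 := if b then 1 else 0

lemma ofBit_inj {a b : Bool} : ofBit a = ofBit b ↔ a = b := by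
  revert a b; decide

@[simp] lemma bit_ofBit (b : Bool) : bit (ofBit b) = b := by revert b; decide

@[simp] lemma ofBit_bit (a : Fin 2) : ofBit (bit a) = a := by revert a; decide

/-- The value of a word whose digit in position `i` has weight `F_{i+k}`. -/
def wordVal : ℕ → List (Fin 2) → ℕ
  | _, [] => 0
  | k, a :: x => a * Nat.fib k + wordVal (k + 1) x

lemma wordVal_eq_sum (k : ℕ) (x : List (Fin 2)) :
    wordVal k x = ∑ i : Fin x.length, (x.get i : ℕ) * Nat.fib (i + k) := by
  induction x generalizing k with
  | nil => simp [wordVal]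
  | cons a x ih =>
    rw [wordVal, ih]
    simp only [List.length_cons, Fin.sum_univ_succ]
    simp [Nat.add_assoc, Nat.add_comm 1 k]

lemma lsdVal_eq_wordVal (x : List (Fin 2)) : lsdVal x = wordVal 2 x :=
  (wordVal_eq_sum 2 x).symm

lemma wordVal_add_two (k : ℕ) (x : List (Fin 2)) :
    wordVal (k + 2) x = wordVal k x + wordVal (k + 1) x := by
  induction x generalizing k with
  | nil => rfl
  | cons a x ih =>
    have := ih (k + 1)
    simp only [wordVal, Nat.fib_add_two]
    rw [show k + 2 + 1 = k + 1 + 2 by omega, this]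
    ring

/-- This links Fibonacci weights to `zshift`. No validity of the word is needed, because
`hofG_zshift_add` has no admissibility hypothesis. -/
lemma wordVal_three (x : List (Fin 2)) : wordVal 3 x = zshift (wordVal 2 x) := by
  induction x with
  | nil => simp [wordVal]
  | cons a x ih =>
    have h := hofG_zshift_add (wordVal 2 x) (bit a)
    rw [bit_toNat] at h
    have h4 := wordVal_add_two 2 x
    have e : wordVal 2 (a :: x) = zshift (wordVal 2 x) + a := by
      simp [wordVal, ih, Nat.add_comm]
    rw [e, zshift, h]
    simp only [wordVal, Nat.reduceAdd] at h4 ⊢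
    rw [h4, ih, show Nat.fib 3 = 2 from rfl]
    ring

@[simp] lemma lsdVal_nil : lsdVal [] = 0 := rfl

lemma lsdVal_cons (a : Fin 2) (x : List (Fin 2)) :
    lsdVal (a :: x) = zshift (lsdVal x) + (bit a).toNat := by
  simp only [lsdVal_eq_wordVal, wordVal, bit_toNat]
  simp [Nat.add_comm, wordVal_three]

lemma lowDigit_lsdVal {x : List (Fin 2)} (hx : IsValidZeckendorf x) :
    lowDigit (lsdVal x) = bit (x.headD 0) := by
  induction x with
  | nil => simp [bit]
  | cons a x ih =>
    rw [lsdVal_cons]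
    refine lowDigit_zshift_add fun ha => ?_
    cases x with
    | nil => simp
    | cons b x =>
      rw [IsValidZeckendorf, List.isChain_cons_cons] at hx
      rw [ih hx.2]
      rw [bit_eq_true] at ha
      have := hx.1
      simp only [ha, true_and] at this
      rw [← Bool.not_eq_true, bit_eq_true]
      simpa using this

lemma isValidZeckendorf_cons {a : Fin 2} {x : List (Fin 2)} (hx : IsValidZeckendorf x) :
    IsValidZeckendorf (a :: x) ↔ (bit a = true → lowDigit (lsdVal x) = false) := by
  rw [lowDigit_lsdVal hx]
  cases x with
  | nil => simp [IsValidZeckendorf, bit]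
  | cons b x =>
    rw [IsValidZeckendorf] at hx ⊢
    rw [List.isChain_cons_cons]
    simp only [hx, and_true, List.headD_cons]
    clear hx
    revert a b; decide

lemma zshift_pos {n : ℕ} (h : 0 < n) : 0 < zshift n := by
  simp only [zshift]; omega

lemma zshift_add_inj {m n : ℕ} {a b : Bool} (ha : a = true → lowDigit m = false)
    (hb : b = true → lowDigit n = false) (h : zshift m + a.toNat = zshift n + b.toNat) :
    m = n ∧ a = b := by
  have h1 := congrArg lowDigit h
  rw [lowDigit_zshift_add ha, lowDigit_zshift_add hb] at h1
  subst h1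
  have h2 := congrArg hofG (Nat.add_right_cancel h)
  rw [hofG_zshift, hofG_zshift] at h2
  exact ⟨h2, rfl⟩

/-- Words without leading zeros (in the most significant positions) are determined by their
values. -/
lemma lsdVal_injective {x y : List (Fin 2)} (hx : IsValidZeckendorf x) (hy : IsValidZeckendorf y)
    (hx0 : x.getLast? ≠ some 0) (hy0 : y.getLast? ≠ some 0) (h : lsdVal x = lsdVal y) : x = y := by
  have pos : ∀ {z : List (Fin 2)}, z ≠ [] → z.getLast? ≠ some 0 → 0 < lsdVal z := by
    intro z hz hz0
    induction z with
    | nil => exact absurd rfl hz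
    | cons a z ih =>
      rw [lsdVal_cons]
      cases z with
      | nil =>
        have : a = 1 := by
          revert hz0; revert a; decide
        simp [this, bit]
      | cons b z =>
        have := ih (by simp) (by simpa using hz0)
        have := zshift_pos this
        omega
  induction x generalizing y with
  | nil =>
    by_contra hne
    have := pos (Ne.symm hne) hy0
    simp at h; omega
  | cons a x ih =>
    cases y with
    | nil =>
      have := pos (List.cons_ne_nil a x) hx0
      simp at h; omega
    | cons b y =>
      have hx' : IsValidZeckendorf x := hx.tail
      have hy' : IsValidZeckendorf y := hy.tail
      rw [isValidZeckendorf_cons hx'] at hx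
      rw [isValidZeckendorf_cons hy'] at hy
      rw [lsdVal_cons, lsdVal_cons] at h
      obtain ⟨h1, h2⟩ := zshift_add_inj hx hy h
      rw [bit_inj] at h2
      subst h2
      rw [ih hx' hy' ?_ ?_ h1]
      · cases x with
        | nil => simp
        | cons => simpa using hx0
      · cases y with
        | nil => simp
        | cons => simpa using hy0

/-! ### The canonical representation and its length -/

lemma zeckendorf_pairwise (n : ℕ) : (n.zeckendorf ++ [0]).Pairwise fun a b => b + 2 ≤ a := by
  have : IsTrans ℕ fun a b => b + 2 ≤ a := ⟨fun a b c h1 h2 => by omega⟩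
  exact List.isChain_iff_pairwise.1 n.isZeckendorfRep_zeckendorf

lemma two_le_of_mem_zeckendorf {n k : ℕ} (h : k ∈ n.zeckendorf) : 2 ≤ k := by
  have := (List.pairwise_append.1 (zeckendorf_pairwise n)).2.2 k h 0 (by simp)
  omega

lemma le_greatestFib_of_mem_zeckendorf {n k : ℕ} (h : k ∈ n.zeckendorf) : k ≤ n.greatestFib := by
  rw [Nat.le_greatestFib]
  conv_rhs => rw [← n.sum_zeckendorf_fib]
  exact List.single_le_sum (by simp) _ (List.mem_map_of_mem h)

lemma succ_notMem_zeckendorf {n k : ℕ} (h : k ∈ n.zeckendorf) : k + 1 ∉ n.zeckendorf := by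
  intro h1
  have hp := (List.pairwise_append.1 (zeckendorf_pairwise n)).1
  obtain ⟨i, hi, rfl⟩ := List.getElem_of_mem h
  obtain ⟨j, hj, hij⟩ := List.getElem_of_mem h1
  rw [List.pairwise_iff_getElem] at hp
  rcases lt_trichotomy i j with hlt | rfl | hlt
  · have := hp i j hi hj hlt; omega
  · omega
  · have := hp j i hj hi hlt; omega

lemma nodup_zeckendorf (n : ℕ) : n.zeckendorf.Nodup :=
  (List.pairwise_append.1 (zeckendorf_pairwise n)).1.imp fun h => by omega

lemma length_fibRep (n : ℕ) : (fibRep n).length = n.greatestFib - 1 := by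
  simp [fibRep]

lemma fibRep_reverse (n : ℕ) : (fibRep n).reverse =
    (List.range (n.greatestFib - 1)).map fun j => if j + 2 ∈ n.zeckendorf then 1 else 0 := by
  rw [fibRep, List.map_reverse, List.reverse_reverse]

lemma isValidZeckendorf_fibRep (n : ℕ) : IsValidZeckendorf (fibRep n).reverse := by
  rw [fibRep_reverse, IsValidZeckendorf, List.isChain_iff_getElem]
  intro i hi
  simp only [List.getElem_map, List.getElem_range]
  rintro ⟨h1, h2⟩
  have h3 : i + 2 ∈ n.zeckendorf := by by_contra h; simp [h] at h1
  have h4 : i + 1 + 2 ∈ n.zeckendorf := by by_contra h; simp [h] at h2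
  exact succ_notMem_zeckendorf h3 (by rwa [show i + 2 + 1 = i + 1 + 2 by omega])

lemma lsdVal_map_range (L : ℕ) (d : ℕ → Fin 2) :
    lsdVal ((List.range L).map d) = ∑ i ∈ Finset.range L, (d i : ℕ) * Nat.fib (i + 2) := by
  unfold lsdVal
  rw [Finset.sum_range]
  refine Fintype.sum_equiv (finCongr (by simp)) _ _ fun i => ?_
  simp

lemma lsdVal_fibRep (n : ℕ) : lsdVal (fibRep n).reverse = n := by
  rw [fibRep_reverse, lsdVal_map_range]
  rcases Nat.eq_zero_or_pos n with rfl | hn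
  · simp
  have hg : 2 ≤ n.greatestFib := by rw [Nat.le_greatestFib]; exact hn
  have h1 : ∑ j ∈ n.zeckendorf.toFinset, Nat.fib j = n := by
    rw [List.sum_toFinset _ (nodup_zeckendorf n), Nat.sum_zeckendorf_fib]
  have h2 : n.zeckendorf.toFinset =
      (Finset.range (n.greatestFib - 1 + 2)).filter (· ∈ n.zeckendorf) := by
    ext j
    simp only [List.mem_toFinset, Finset.mem_filter, Finset.mem_range, iff_and_self]
    intro hj
    have := le_greatestFib_of_mem_zeckendorf hj
    omega
  rw [h2, Finset.sum_filter, Finset.sum_range_succ', Finset.sum_range_succ'] at h1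
  have h3 : 1 ∉ n.zeckendorf := fun h => by have := two_le_of_mem_zeckendorf h; omega
  simp only [h3, Nat.fib_zero, ite_self, Nat.add_zero, Nat.zero_add, if_false] at h1
  refine Eq.trans ?_ h1
  refine Finset.sum_congr rfl fun i _ => ?_
  rw [Nat.add_assoc]
  split_ifs <;> simp

lemma getLast?_fibRep_reverse (n : ℕ) : (fibRep n).reverse.getLast? ≠ some 0 := by
  rcases Nat.eq_zero_or_pos n with rfl | hn
  · simp [fibRep, Nat.greatestFib_eq_zero.2]
  have hg : 2 ≤ n.greatestFib := by rw [Nat.le_greatestFib]; exact hn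
  rw [fibRep_reverse, show n.greatestFib - 1 = n.greatestFib - 2 + 1 by omega, List.range_succ]
  simp only [List.map_append, List.map_cons, List.map_nil, List.getLast?_append_cons]
  simp [Nat.sub_add_cancel hg, Nat.zeckendorf_of_pos hn]

lemma fibWord_eq (n : ℕ) : fibWord n = ofBit (lowDigit n) := by
  have h := lowDigit_lsdVal (isValidZeckendorf_fibRep n)
  rw [lsdVal_fibRep] at h
  rw [h, ofBit_bit, fibWord]
  simp [List.getLastD_eq_getLast?, List.headD_eq_head?_getD]

@[simp] lemma fibRep_zero : fibRep 0 = [] := by simp [fibRep, Nat.greatestFib_eq_zero.2]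

/-- Appending a digit to the canonical representation. -/
lemma fibRep_zshift {m : ℕ} {a : Bool} (h : a = true → lowDigit m = false)
    (h0 : 0 < zshift m + a.toNat) :
    fibRep (zshift m + a.toNat) = fibRep m ++ [ofBit a] := by
  rw [← List.reverse_inj]
  refine lsdVal_injective (isValidZeckendorf_fibRep _) ?_ (getLast?_fibRep_reverse _) ?_ ?_
  · rw [List.reverse_append, List.reverse_singleton, List.singleton_append,
      isValidZeckendorf_cons (isValidZeckendorf_fibRep m), lsdVal_fibRep]
    simpa using h
  · rcases Nat.eq_zero_or_pos m with rfl | hm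
    · cases a
      · simp at h0
      · simp [ofBit]
    · have hne : (fibRep m).reverse ≠ [] := by
        intro h
        have := lsdVal_fibRep m
        simp [h] at this; omega
      have := getLast?_fibRep_reverse m
      rw [List.reverse_append, List.reverse_singleton, List.singleton_append]
      obtain ⟨b, l, hbl⟩ := List.exists_cons_of_ne_nil hne
      rw [hbl] at this ⊢
      simpa using this
  · rw [lsdVal_fibRep, List.reverse_append, List.reverse_singleton, List.singleton_append,
      lsdVal_cons, lsdVal_fibRep, bit_ofBit]

lemma length_fibRep_zshift {m : ℕ} {a : Bool} (h : a = true → lowDigit m = false)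
    (h0 : 0 < zshift m + a.toNat) :
    (fibRep (zshift m + a.toNat)).length = (fibRep m).length + 1 := by
  rw [fibRep_zshift h h0]; simp

/-- The digit before a zero-ended number. -/
lemma lowDigit_zshift_pred {n : ℕ} : lowDigit (zshift (n + 1) - 1) = !lowDigit n := by
  have h := zshift_succ n
  cases hd : lowDigit n
  · rw [hd] at h
    rw [show zshift (n + 1) - 1 = zshift n + 1 by simp at h; omega, lowDigit_zshift_succ, hd]
  · rw [hd] at h
    rw [show zshift (n + 1) - 1 = zshift n by simp at h; omega, lowDigit_zshift]
    rfl

/-- This makes the chain `u + 1 ↦ hofG u` lose one digit per step when measured by the length of the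
successor. Writing `u + 2` as the shift of `m` plus a digit, `hofG u + 1` is `m` or `m + 1`, and it
is `m + 1` only where `m` and `m + 1` differ in the last digit alone and so have equal length. -/
lemma length_fibRep_add_two (u : ℕ) :
    (fibRep (u + 2)).length = (fibRep (hofG u + 1)).length + 1 := by
  obtain ⟨m, hm, ha⟩ := exists_zshift (u + 2)
  have h1 := hofG_succ_eq u
  have h2 : hofG (u + 2) + (lowDigit (u + 1)).toNat = hofG (u + 1) + 1 := hofG_succ_eq (u + 1)
  have h3 : hofG (u + 2) = m + (lowDigit (u + 2)).toNat := by
    conv_lhs => rw [hm]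
    exact hofG_zshift_add _ _
  have hlen := length_fibRep_zshift ha (by omega)
  rw [← hm] at hlen
  rw [hlen]
  congr 1
  have hm0 : m ≠ 0 := by
    rintro rfl
    have := Bool.toNat_le (lowDigit (u + 2))
    simp at hm; omega
  obtain ⟨k, rfl⟩ := Nat.exists_eq_succ_of_ne_zero hm0
  have hp := @lowDigit_zshift_pred k
  rw [Nat.succ_eq_add_one] at *
  cases hl : lowDigit (u + 2)
  · rw [hl] at hm h3
    simp only [Bool.toNat_false, Nat.add_zero] at hm h3
    rw [← hm, show u + 2 - 1 = u + 1 by omega] at hp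
    have h4 : (lowDigit u).toNat + (lowDigit (u + 1)).toNat = 1 := by
      rw [hp]
      cases hk : lowDigit k
      · rw [hk] at hp
        cases hu : lowDigit u
        · rfl
        · rw [lowDigit_succ_of_true hu] at hp; simp at hp
      · have h5 := zshift_succ k
        rw [hk, ← hm] at h5
        have h6 : u + 1 = zshift k := by simp at h5; omega
        have hk0 : k ≠ 0 := by rintro rfl; simp at hk
        obtain ⟨j, rfl⟩ := Nat.exists_eq_succ_of_ne_zero hk0
        have h7 := @lowDigit_zshift_pred j
        rw [← Nat.succ_eq_add_one, ← h6] at h7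
        simp only [Nat.add_sub_cancel] at h7
        have h8 : lowDigit j = false := by
          by_contra hj
          rw [lowDigit_succ_of_true (by simpa using hj)] at hk
          simp at hk
        simp [h7, h8]
    rw [show hofG u + 1 = k + 1 by omega]
  · rw [hl] at hm h3
    have hz := ha hl
    simp only [Bool.toNat_true] at hm h3
    rw [show zshift (k + 1) = u + 1 by omega] at hp
    simp only [Nat.add_sub_cancel] at hp
    have h4 : lowDigit (u + 1) = false := by
      rw [show u + 1 = zshift (k + 1) by omega]; simp
    rw [h4, Bool.toNat_false] at h2
    cases hk : lowDigit k
    · rw [hk] at hp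
      rw [hp] at h1
      have h5 : hofG u + 1 = k + 2 := by simp at h1; omega
      rw [h5]
      obtain ⟨q, hq, -⟩ := exists_zshift (k + 1)
      rw [hz] at hq
      simp only [Bool.toNat_false, Nat.add_zero] at hq
      have hq0 : q ≠ 0 := by rintro rfl; simp at hq
      obtain ⟨j, rfl⟩ := Nat.exists_eq_succ_of_ne_zero hq0
      have h6 := @lowDigit_zshift_pred j
      rw [← Nat.succ_eq_add_one, ← hq] at h6
      simp only [Nat.add_sub_cancel, hk] at h6
      have h7 : lowDigit (j + 1) = false := lowDigit_succ_of_true (by simpa using h6.symm)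
      have e1 := @length_fibRep_zshift (j + 1) true (fun _ => h7) (by simp)
      have e2 := @length_fibRep_zshift (j + 1) false (by simp) (by simp [zshift])
      simp only [Bool.toNat_true, Bool.toNat_false, Nat.add_zero] at e1 e2
      rw [show k + 2 = k + 1 + 1 from rfl, hq]
      simp only [Nat.succ_eq_add_one] at *
      omega
    · rw [hk] at hp
      rw [hp] at h1
      rw [show hofG u + 1 = k + 1 by simp at h1; omega]

/-! ### The automaton of pending carries -/

/-- States of the automata generating the shifts of the Fibonacci word: the last digit `b`, up to
two carries that are still undetermined, and the parity `s` of everything that is determined. -/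
inductive ShiftState
  | dead (b s : Bool)
  | one (b : Bool) (u : ℕ) (s : Bool)
  | two (b : Bool) (u : ℕ) (s : Bool)
  deriving DecidableEq

namespace ShiftState

/-- The digit that was read last. -/
def last : ShiftState → Bool
  | dead b _ => b
  | one b _ _ => b
  | two b _ _ => b

/-- The output after reading the digits of `n`. -/
noncomputable def sem : ShiftState → ℕ → Bool
  | dead _ s, _ => s
  | one _ u s, n => s ^^ carry u n
  | two _ u s, n => s ^^ carry u n ^^ carry (u + 1) n

/-- The transition function, regardless of the last digit. -/
noncomputable def step : ShiftState → Bool → ShiftState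
  | dead _ s, a => dead a s
  | one _ 0 s, a => dead a (s ^^ !a)
  | one _ (u + 1) s, a => if a = lowDigit u then one a (hofG u) (!s) else dead a (s ^^ !a)
  | two _ 0 s, a => if a then dead a s else one a 0 s
  | two _ (u + 1) s, a =>
      if a = lowDigit u then
        if a = lowDigit (u + 1) then two a (hofG u) s else one a (hofG u) (s ^^ a)
      else if a = lowDigit (u + 1) then one a (hofG (u + 1)) (s ^^ a) else dead a s

@[simp] lemma last_step (q : ShiftState) (a : Bool) : (q.step a).last = a := by
  rcases q with ⟨b, s⟩ | ⟨b, _ | u, s⟩ | ⟨b, _ | u, s⟩ <;> simp only [step] <;>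
    (try split_ifs) <;> rfl

lemma carry_zero_zshift {m : ℕ} {a : Bool} (ha : a = true → lowDigit m = false) :
    carry 0 (zshift m + a.toNat) = !a := by
  rw [carry_zero_left, lowDigit_zshift_add ha]

/-- Correctness of one transition: reading `a` strips the lowest digit from the number still to be
read. It is `carry_succ` applied to each pending carry; when both agree with `a`, their two
negations cancel. -/
lemma sem_step (q : ShiftState) {m : ℕ} {a : Bool} (ha : a = true → lowDigit m = false) :
    (q.step a).sem m = q.sem (zshift m + a.toNat) := by
  rcases q with ⟨b, s⟩ | ⟨b, _ | u, s⟩ | ⟨b, _ | u, s⟩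
  · rfl
  · simp only [step, sem, carry_zero_zshift ha]
  · simp only [step, sem, carry_succ _ _ _ ha]
    split_ifs <;> simp
  · simp only [step, sem, carry_succ _ _ _ ha, carry_zero_zshift ha, lowDigit_zero, hofG_zero]
    cases a <;> simp
  · simp only [step, sem, carry_succ _ _ _ ha]
    have hG := hofG_succ_eq u
    have h11 := @lowDigit_succ_of_true u
    cases a <;> cases h1 : lowDigit u <;> cases h2 : lowDigit (u + 1) <;> simp_all

/-- The partial transition function on binary digits. -/
noncomputable def next (q : ShiftState) (a : Fin 2) : Option ShiftState :=
  if (q.last && bit a) = true then none else some (q.step (bit a))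

lemma foldlM_next (x : List (Fin 2)) (q : ShiftState) :
    (IsValidZeckendorf x ∧ (q.last = true → lowDigit (lsdVal x) = false) →
      ∃ q', x.foldlM next q = some q' ∧ q'.sem 0 = q.sem (lsdVal x)) ∧
    (¬ (IsValidZeckendorf x ∧ (q.last = true → lowDigit (lsdVal x) = false)) →
      x.foldlM next q = none) := by
  induction x generalizing q with
  | nil => simp [IsValidZeckendorf]
  | cons a x ih =>
    obtain ⟨ih1, ih2⟩ := ih (q.step (bit a))
    rw [last_step] at ih1 ih2
    have hval : IsValidZeckendorf (a :: x) ↔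
        IsValidZeckendorf x ∧ (bit a = true → lowDigit (lsdVal x) = false) := by
      constructor
      · intro h
        have h' : IsValidZeckendorf x := h.tail
        exact ⟨h', (isValidZeckendorf_cons h').1 h⟩
      · rintro ⟨h1, h2⟩
        exact (isValidZeckendorf_cons h1).2 h2
    rw [hval, List.foldlM_cons, lsdVal_cons]
    constructor
    · rintro ⟨h1, h2⟩
      rw [lowDigit_zshift_add h1.2] at h2
      obtain ⟨q', hq1, hq2⟩ := ih1 h1
      refine ⟨q', ?_, ?_⟩
      · rw [next, if_neg]
        · exact hq1
        · cases hl : q.last <;> simp_all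
      · rw [hq2, sem_step _ h1.2]
    · intro h
      rw [next]
      split_ifs with hb
      · rfl
      · refine ih2 fun h1 => h ⟨h1, fun hl => ?_⟩
        rw [lowDigit_zshift_add h1.2]
        cases hc : bit a <;> simp_all

/-- The initial state for the sequence `f(i + c)`. -/
noncomputable def start : ℕ → ShiftState
  | 0 => one false 0 true
  | c + 1 => two false c (lowDigit c)

lemma last_start (c : ℕ) : (start c).last = false := by cases c <;> rfl

lemma sem_start (c n : ℕ) : (start c).sem n = lowDigit (n + c) := by
  cases c with
  | zero => simp [start, sem, carry_zero_left]
  | succ c => simp only [start, sem, ← Nat.add_assoc, lowDigit_add]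

/-- An infinite automaton generating `f(i + c)`. -/
noncomputable def automaton (c : ℕ) : DFAO ShiftState (Fin 2) (Fin 2) where
  δ := next
  q₀ := start c
  τ q := ofBit (q.sem 0)

lemma automaton_generatesLsd (c : ℕ) :
    (automaton c).GeneratesLsd fun i => fibWord (i + c) := by
  intro x
  obtain ⟨h1, h2⟩ := foldlM_next x (start c)
  simp only [last_start, Bool.false_eq_true, false_implies, and_true] at h1 h2
  refine ⟨fun hx => ?_, h2⟩
  obtain ⟨q', hq, hs⟩ := h1 hx
  exact ⟨q', hq, by simp only [fibWord_eq, ← sem_start, ← hs]; rfl⟩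

/-! ### Distinct good states are distinguishable -/

/-- The observable behaviour of a state. -/
noncomputable def behaviour (q : ShiftState) (x : List (Fin 2)) : Option Bool :=
  (x.foldlM next q).map fun q' => q'.sem 0

lemma behaviour_nil (q : ShiftState) : q.behaviour [] = some (q.sem 0) := rfl

lemma behaviour_cons (q : ShiftState) (a : Fin 2) (x : List (Fin 2)) :
    q.behaviour (a :: x) =
      if (q.last && bit a) = true then none else (q.step (bit a)).behaviour x := by
  unfold behaviour
  rw [List.foldlM_cons, next]
  split_ifs <;> rfl

lemma last_eq_of_behaviour_eq {q q' : ShiftState} (h : q.behaviour = q'.behaviour) :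
    q.last = q'.last := by
  -- The probe `1` is rejected exactly when the last digit was `1`.
  have h1 := congrFun h [1]
  rw [behaviour_cons, behaviour_cons, behaviour_nil, behaviour_nil] at h1
  cases h2 : q.last <;> cases h3 : q'.last <;> simp [h2, h3, bit] at h1 ⊢

lemma behaviour_step_eq {q q' : ShiftState} (h : q.behaviour = q'.behaviour) (a : Bool)
    (ha : a = true → q.last = false) : (q.step a).behaviour = (q'.step a).behaviour := by
  funext x
  have h1 := congrFun h (ofBit a :: x)
  have h2 := last_eq_of_behaviour_eq h
  rw [behaviour_cons, behaviour_cons, ← h2, bit_ofBit, if_neg, if_neg] at h1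
  · exact h1
  all_goals cases a <;> simp_all

/-- The states that do not contain redundant data. -/
def Good : ShiftState → Prop
  | dead _ _ => True
  | one b u _ => b = true → ∃ v, u = v + 1 ∧ lowDigit v = false
  | two b u _ => b = false ∧ u ≠ 0

lemma exists_hofG (u : ℕ) : ∃ q, u = zshift q + (lowDigit u).toNat ∧
    hofG u = q + (lowDigit u).toNat ∧ (lowDigit u = true → lowDigit q = false) := by
  obtain ⟨q, hq, hb⟩ := exists_zshift u
  refine ⟨q, hq, ?_, hb⟩
  conv_lhs => rw [hq]
  exact hofG_zshift_add _ _

lemma hofG_le_self (u : ℕ) : hofG u ≤ u := by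
  obtain ⟨q, hq, h1, -⟩ := exists_hofG u
  simp only [zshift] at hq; omega

lemma exists_of_lowDigit {u : ℕ} (h : lowDigit u = true) :
    ∃ v, hofG u = v + 1 ∧ lowDigit v = false := by
  obtain ⟨q, -, hG, hb⟩ := exists_hofG u
  exact ⟨q, by simpa [h] using hG, hb h⟩

lemma good_one_step {s : Bool} {u : ℕ} : Good (one (lowDigit u) (hofG u) s) :=
  fun h => exists_of_lowDigit h

/-- `u` is determined by its lowest digit and its right shift. -/
lemma eq_of_hofG_eq {u v : ℕ} (h : hofG u = hofG v) (hd : lowDigit u = lowDigit v) : u = v := by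
  obtain ⟨q, hq, h1, -⟩ := exists_hofG u
  obtain ⟨r, hr, h2, -⟩ := exists_hofG v
  rw [hd] at h1 hq
  obtain rfl : q = r := by omega
  exact hq.trans hr.symm

lemma step_one_digit (b s : Bool) (u : ℕ) :
    (one b (u + 1) s).step (lowDigit u) = one (lowDigit u) (hofG u) (!s) := by simp [step]

lemma step_one_not (b s : Bool) (u : ℕ) :
    (one b (u + 1) s).step (!lowDigit u) = dead (!lowDigit u) (s ^^ lowDigit u) := by
  simp [step]

lemma Good.admissible {b s : Bool} {u : ℕ} (h : Good (one b (u + 1) s)) :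
    lowDigit u = true → (one b (u + 1) s).last = false := by
  intro hd
  cases hb : b
  · rfl
  · obtain ⟨v, hv, hv2⟩ := h hb
    simp at hv; subst hv; simp [hd] at hv2

/-- Reading the prescribed digits keeps the carry pending until `u = 0`, where the next digit still
changes the output; a settled state has constant output. `Good` makes the prescribed digits
admissible. -/
lemma behaviour_one_ne_dead {b s b' s' : Bool} {u : ℕ} (hg : Good (one b u s)) :
    (one b u s).behaviour ≠ (dead b' s').behaviour := by
  induction u using Nat.strong_induction_on generalizing b s b' with
  | _ u ih =>
    intro h
    cases u with
    | zero =>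
      have hb : b = false := by
        by_contra hb
        obtain ⟨v, hv, -⟩ := hg (by simpa using hb)
        simp at hv
      have h0 := congrFun (behaviour_step_eq h false (by simp)) []
      have h1 := congrFun (behaviour_step_eq h true (fun _ => hb)) []
      simp only [step, behaviour_nil, sem] at h0 h1
      rw [← h1] at h0
      simp at h0
    | succ u =>
      have h0 := behaviour_step_eq h (lowDigit u) hg.admissible
      rw [step_one_digit] at h0
      refine ih (hofG u) ?_ good_one_step h0
      exact Nat.lt_succ_of_le (hofG_le_self u)

/-- Feeding the digits prescribed by `u` would settle the other carry at the first disagreement. If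
there is none, `u` and `u'` are rebuilt from equal digits and equal right shifts. -/
lemma behaviour_one_inj {b s b' s' : Bool} {u u' : ℕ} (hg : Good (one b u s))
    (hg' : Good (one b' u' s')) (h : (one b u s).behaviour = (one b' u' s').behaviour) :
    b = b' ∧ u = u' ∧ s = s' := by
  have hlast : b = b' := last_eq_of_behaviour_eq h
  refine ⟨hlast, ?_⟩
  subst hlast
  induction u using Nat.strong_induction_on generalizing b s u' s' with
  | _ u ih =>
    cases u with
    | zero =>
      cases u' with
      | zero =>
        have h0 := congrFun (behaviour_step_eq h false (by simp)) []
        simpa [step, behaviour_nil, sem] using h0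
      | succ u' =>
        have h0 := behaviour_step_eq h.symm (lowDigit u') hg'.admissible
        rw [step_one_digit] at h0
        exact absurd h0 (behaviour_one_ne_dead good_one_step)
    | succ u =>
      have h0 := behaviour_step_eq h (lowDigit u) hg.admissible
      rw [step_one_digit] at h0
      cases u' with
      | zero => exact absurd h0 (behaviour_one_ne_dead good_one_step)
      | succ u' =>
        by_cases hd : lowDigit u = lowDigit u'
        · have hg1 := @good_one_step (!s) u
          have hg2 := @good_one_step (!s') u'
          rw [hd, step_one_digit, ← hd] at h0
          rw [← hd] at hg2
          obtain ⟨h1, h2⟩ := ih _ (Nat.lt_succ_of_le (hofG_le_self u)) hg1 hg2 h0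
          exact ⟨by rw [eq_of_hofG_eq h1 hd], by simpa using h2⟩
        · have hd' : lowDigit u = !lowDigit u' := Bool.eq_not.2 hd
          rw [hd', step_one_not, ← hd'] at h0
          exact absurd h0 (behaviour_one_ne_dead good_one_step)

/-- With opposite prescribed digits, every digit settles exactly one of the two carries and leaves
the other pending. -/
lemma step_two_of_ne {v : ℕ} (hv : lowDigit v ≠ lowDigit (v + 1)) (b s a : Bool) :
    ∃ u, (two b (v + 1) s).step a = one a u (s ^^ a) ∧ Good (one a u (s ^^ a)) ∧
      (a = lowDigit v → u = hofG v) ∧ (a = lowDigit (v + 1) → u = hofG (v + 1)) := by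
  by_cases ha : a = lowDigit v
  · subst ha
    exact ⟨hofG v, by simp [step, hv], good_one_step, fun _ => rfl, fun h => absurd h hv⟩
  · have ha' : a = lowDigit (v + 1) := by
      cases h1 : lowDigit v <;> cases h2 : lowDigit (v + 1) <;> simp_all
    subst ha'
    exact ⟨hofG (v + 1), by simp [step, hv.symm], good_one_step,
      fun h => absurd h ha, fun _ => rfl⟩

/-- If the two carries have the same next digit, their next but one digits differ. -/
lemma step_two_of_eq {v : ℕ} (hv : lowDigit v = lowDigit (v + 1)) (b s : Bool) :
    (two b (v + 1) s).step false = two false (hofG v) s ∧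
    (two b (v + 1) s).step true = dead true s ∧
    ∃ w, hofG v = w + 1 ∧ lowDigit w ≠ lowDigit (w + 1) := by
  -- The Fibonacci word has no factor `11`, so equal prescribed digits are both `0`.
  have h0 : lowDigit v = false := by
    by_contra h
    have h1 : lowDigit v = true := by simpa using h
    rw [lowDigit_succ_of_true h1, h1] at hv
    simp at hv
  rw [h0] at hv
  refine ⟨by simp [step, h0, ← hv], by simp [step, h0, ← hv], ?_⟩
  obtain ⟨q, hq, hG, -⟩ := exists_hofG v
  simp only [h0, Bool.toNat_false, Nat.add_zero] at hq hG
  rw [hq, lowDigit_zshift_succ] at hv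
  have hq1 : lowDigit q = true := by simpa using hv.symm
  have hq0 : q ≠ 0 := by rintro rfl; simp at hq1
  obtain ⟨w, rfl⟩ := Nat.exists_eq_succ_of_ne_zero hq0
  refine ⟨w, hG, fun h => ?_⟩
  rw [Nat.succ_eq_add_one] at hq1
  rw [hq1] at h
  rw [lowDigit_succ_of_true h] at hq1
  simp at hq1

lemma behaviour_two_ne_dead_of_ne {v : ℕ} (hv : lowDigit v ≠ lowDigit (v + 1))
    (b s b' s' : Bool) : (two b (v + 1) s).behaviour ≠ (dead b' s').behaviour := by
  intro h
  have h0 := behaviour_step_eq h false (by simp)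
  obtain ⟨u, hu, hg, -⟩ := step_two_of_ne hv b s false
  rw [hu] at h0
  exact behaviour_one_ne_dead hg h0

lemma behaviour_two_ne_dead (v : ℕ) (b s b' s' : Bool) :
    (two b (v + 1) s).behaviour ≠ (dead b' s').behaviour := by
  by_cases hv : lowDigit v = lowDigit (v + 1)
  · intro h
    have h0 := behaviour_step_eq h false (by simp)
    obtain ⟨h1, -, w, hw, hne⟩ := step_two_of_eq hv b s
    rw [h1, hw] at h0
    exact behaviour_two_ne_dead_of_ne hne _ _ _ _ h0
  · exact behaviour_two_ne_dead_of_ne hv _ _ _ _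

lemma behaviour_two_ne_one_of_ne {v : ℕ} (hv : lowDigit v ≠ lowDigit (v + 1))
    (s s' : Bool) (b' : Bool) (u : ℕ) :
    (two false (v + 1) s).behaviour ≠ (one b' u s').behaviour := by
  intro h
  cases u with
  | zero =>
    have h0 := behaviour_step_eq h false (by simp)
    obtain ⟨u, hu, hg, -⟩ := step_two_of_ne hv false s false
    rw [hu] at h0
    exact behaviour_one_ne_dead hg h0
  | succ u' =>
    -- This digit settles the single carry, while one of the two others stays pending.
    have h0 := behaviour_step_eq h (!lowDigit u') (by simp [last])
    obtain ⟨u, hu, hg, -⟩ := step_two_of_ne hv false s (!lowDigit u')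
    rw [hu, step_one_not] at h0
    exact behaviour_one_ne_dead hg h0

lemma behaviour_two_ne_one (v : ℕ) (s s' : Bool) (b' : Bool) (u : ℕ) :
    (two false (v + 1) s).behaviour ≠ (one b' u s').behaviour := by
  by_cases hv : lowDigit v = lowDigit (v + 1)
  · intro h
    have h0 := behaviour_step_eq h false (by simp)
    obtain ⟨h1, -, w, hw, hne⟩ := step_two_of_eq hv false s
    rw [h1, hw] at h0
    cases u with
    | zero => exact behaviour_two_ne_dead_of_ne hne _ _ _ _ h0
    | succ u =>
      rw [step] at h0
      split_ifs at h0
      · exact behaviour_two_ne_one_of_ne hne _ _ _ _ h0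
      · exact behaviour_two_ne_dead_of_ne hne _ _ _ _ h0
  · exact behaviour_two_ne_one_of_ne hv _ _ _ _

lemma behaviour_two_inj_of_ne {v v' : ℕ} (hv : lowDigit v ≠ lowDigit (v + 1))
    (hv' : lowDigit v' ≠ lowDigit (v' + 1)) {s s' : Bool}
    (h : (two false (v + 1) s).behaviour = (two false (v' + 1) s').behaviour) :
    v = v' ∧ s = s' := by
  have key : ∀ a, ∃ u, ((a = lowDigit v → u = hofG v) ∧
      (a = lowDigit (v + 1) → u = hofG (v + 1))) ∧ ((a = lowDigit v' → u = hofG v') ∧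
      (a = lowDigit (v' + 1) → u = hofG (v' + 1))) ∧ s = s' := by
    intro a
    obtain ⟨u, hu, hg, h2⟩ := step_two_of_ne hv false s a
    obtain ⟨u', hu', hg', h2'⟩ := step_two_of_ne hv' false s' a
    have h0 := behaviour_step_eq h a (fun _ => rfl)
    rw [hu, hu'] at h0
    obtain ⟨-, rfl, h4⟩ := behaviour_one_inj hg hg' h0
    exact ⟨u, h2, h2', by simpa using h4⟩
  obtain ⟨x, ⟨h1, -⟩, ⟨h3, h4⟩, hs⟩ := key (lowDigit v)
  obtain ⟨y, ⟨-, h6⟩, ⟨h7, -⟩, -⟩ := key (lowDigit (v + 1))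
  refine ⟨?_, hs⟩
  by_cases hd : lowDigit v = lowDigit v'
  · exact eq_of_hofG_eq ((h1 rfl).symm.trans (h3 hd)) hd
  · have hd2 : lowDigit v = lowDigit (v' + 1) :=
      (Bool.eq_not.2 hd).trans (Bool.eq_not.2 hv'.symm).symm
    have hd3 : lowDigit (v + 1) = lowDigit v' :=
      (Bool.eq_not.2 hv.symm).trans (Bool.eq_not.2 (Ne.symm hd)).symm
    -- A crossed matching of the carries would force both `v = v' + 1` and `v + 1 = v'`.
    have e1 := eq_of_hofG_eq ((h1 rfl).symm.trans (h4 hd2)) hd2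
    have e2 := eq_of_hofG_eq ((h6 rfl).symm.trans (h7 hd3)) hd3
    omega

lemma behaviour_two_inj {v v' : ℕ} {s s' : Bool}
    (h : (two false (v + 1) s).behaviour = (two false (v' + 1) s').behaviour) :
    v = v' ∧ s = s' := by
  by_cases hv : lowDigit v = lowDigit (v + 1) <;> by_cases hv' : lowDigit v' = lowDigit (v' + 1)
  · have h0 := behaviour_step_eq h false (by simp)
    obtain ⟨h1, -, w, hw, hne⟩ := step_two_of_eq hv false s
    obtain ⟨h1', -, w', hw', hne'⟩ := step_two_of_eq hv' false s'
    rw [h1, h1', hw, hw'] at h0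
    obtain ⟨h2, h3⟩ := behaviour_two_inj_of_ne hne hne' h0
    refine ⟨eq_of_hofG_eq (by omega) ?_, h3⟩
    have := @lowDigit_succ_of_true v
    have := @lowDigit_succ_of_true v'
    cases hd : lowDigit v <;> cases hd' : lowDigit v' <;> simp_all
  · have h0 := behaviour_step_eq h true (fun _ => rfl)
    obtain ⟨u, hu, hg, -⟩ := step_two_of_ne hv' false s' true
    rw [(step_two_of_eq hv false s).2.1, hu] at h0
    exact absurd h0.symm (behaviour_one_ne_dead hg)
  · have h0 := behaviour_step_eq h true (fun _ => rfl)
    obtain ⟨u, hu, hg, -⟩ := step_two_of_ne hv false s true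
    rw [(step_two_of_eq hv' false s').2.1, hu] at h0
    exact absurd h0 (behaviour_one_ne_dead hg)
  · exact behaviour_two_inj_of_ne hv hv' h

/-- Good states with the same behaviour are equal. -/
lemma eq_of_behaviour_eq {q q' : ShiftState} (hq : Good q) (hq' : Good q')
    (h : q.behaviour = q'.behaviour) : q = q' := by
  rcases q with ⟨b, s⟩ | ⟨b, u, s⟩ | ⟨b, u, s⟩ <;>
    rcases q' with ⟨b', s'⟩ | ⟨b', u', s'⟩ | ⟨b', u', s'⟩
  · have h1 := last_eq_of_behaviour_eq h
    have h2 := congrFun h []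
    simp only [last, behaviour_nil, sem, Option.some.injEq] at h1 h2
    rw [h1, h2]
  · exact absurd h.symm (behaviour_one_ne_dead hq')
  · obtain ⟨rfl, hu⟩ := hq'
    obtain ⟨v, rfl⟩ := Nat.exists_eq_succ_of_ne_zero hu
    exact absurd h.symm (behaviour_two_ne_dead v _ _ _ _)
  · exact absurd h (behaviour_one_ne_dead hq)
  · obtain ⟨rfl, rfl, rfl⟩ := behaviour_one_inj hq hq' h
    rfl
  · obtain ⟨rfl, hu⟩ := hq'
    obtain ⟨v, rfl⟩ := Nat.exists_eq_succ_of_ne_zero hu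
    exact absurd h.symm (behaviour_two_ne_one v _ _ _ _)
  · obtain ⟨rfl, hu⟩ := hq
    obtain ⟨v, rfl⟩ := Nat.exists_eq_succ_of_ne_zero hu
    exact absurd h (behaviour_two_ne_dead v _ _ _ _)
  · obtain ⟨rfl, hu⟩ := hq
    obtain ⟨v, rfl⟩ := Nat.exists_eq_succ_of_ne_zero hu
    exact absurd h (behaviour_two_ne_one v _ _ _ _)
  · obtain ⟨rfl, hu⟩ := hq
    obtain ⟨rfl, hu'⟩ := hq'
    obtain ⟨v, rfl⟩ := Nat.exists_eq_succ_of_ne_zero hu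
    obtain ⟨v', rfl⟩ := Nat.exists_eq_succ_of_ne_zero hu'
    obtain ⟨rfl, rfl⟩ := behaviour_two_inj h
    rfl

end ShiftState

/-! ### Minimality by reachability and distinguishability -/

namespace ShiftState

/-- The states that are reachable from the initial state for `f(i + c)`. -/
def Reachable (c : ℕ) (q : ShiftState) : Prop := ∃ x, (automaton c).run x = some q

lemma reachable_start (c : ℕ) : Reachable c (start c) := ⟨[], rfl⟩

lemma Reachable.step {c : ℕ} {q : ShiftState} (h : Reachable c q) (a : Bool)
    (ha : a = true → q.last = false) : Reachable c (q.step a) := by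
  obtain ⟨x, hx⟩ := h
  refine ⟨x ++ [ofBit a], ?_⟩
  rw [DFAO.run] at hx ⊢
  rw [List.foldlM_append, hx]
  change (List.foldlM next q [ofBit a]) = _
  rw [List.foldlM_cons, next, if_neg]
  · simp
  · rw [bit_ofBit]
    cases a <;> simp_all

/-- A finite set of states that contains the initial state and is closed under transitions is the
state set of an automaton for `f(i + c)`. -/
lemma card_mem_lsdStateCounts (c : ℕ) (K : Finset ShiftState) (h0 : start c ∈ K)
    (hK : ∀ q ∈ K, ∀ a, q.step a ∈ K) :
    K.card ∈ lsdStateCounts fun i => fibWord (i + c) := by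
  let M : DFAO K (Fin 2) (Fin 2) :=
    { δ := fun q a => if (q.1.last && bit a) = true then none
        else some ⟨q.1.step (bit a), hK q.1 q.2 _⟩
      q₀ := ⟨start c, h0⟩
      τ := fun q => ofBit (q.1.sem 0) }
  have hrun : ∀ (x : List (Fin 2)) (q : K),
      (x.foldlM M.δ q).map Subtype.val = x.foldlM next q.1 := by
    intro x
    induction x with
    | nil => intro q; rfl
    | cons a x ih =>
      intro q
      rw [List.foldlM_cons, List.foldlM_cons, next]
      simp only [M]
      split_ifs
      · rfl
      · exact ih _
  let e : K ≃ Fin K.card := K.equivFin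
  refine ⟨Fin K.card, inferInstance, ⟨fun q a => (M.δ (e.symm q) a).map e, e M.q₀,
    fun q => M.τ (e.symm q)⟩, ?_, by simp⟩
  have hrun' : ∀ (x : List (Fin 2)) (q : K),
      x.foldlM (fun q a => (M.δ (e.symm q) a).map e) (e q) = (x.foldlM M.δ q).map e := by
    intro x
    induction x with
    | nil => intro q; rfl
    | cons a x ih =>
      intro q
      rw [List.foldlM_cons, List.foldlM_cons, Equiv.symm_apply_apply]
      cases hδ : M.δ q a with
      | none => rfl
      | some q' => exact ih q'
  intro x
  obtain ⟨h1, h2⟩ := automaton_generatesLsd c x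
  simp only [DFAO.run] at h1 h2 ⊢
  rw [hrun']
  have h3 := hrun x M.q₀
  constructor
  · intro hx
    obtain ⟨q, hq, hτ⟩ := h1 hx
    change List.foldlM next (start c) x = some q at hq
    rw [show M.q₀.1 = start c from rfl, hq, Option.map_eq_some_iff] at h3
    obtain ⟨r, hr, hrq⟩ := h3
    refine ⟨e r, by rw [hr]; rfl, ?_⟩
    rw [Equiv.symm_apply_apply, ← hτ, ← hrq]
    rfl
  · intro hx
    have h4 : List.foldlM next (start c) x = none := h2 hx
    rw [show M.q₀.1 = start c from rfl, h4, Option.map_eq_none_iff] at h3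
    rw [h3]; rfl

/-- Myhill–Nerode: a word leading to a state of `K` leads, in any competing automaton, to a state
with the same behaviour, and good states with the same behaviour coincide. -/
lemma card_le_of_generatesLsd (c : ℕ) (K : Finset ShiftState) (hR : ∀ q ∈ K, Reachable c q)
    (hG : ∀ q ∈ K, Good q) {Q : Type} [Fintype Q] (M : DFAO Q (Fin 2) (Fin 2))
    (hM : M.GeneratesLsd fun i => fibWord (i + c)) : K.card ≤ Fintype.card Q := by
  have hrun : ∀ x, (M.run x).map M.τ = ((automaton c).run x).map (automaton c).τ := by
    intro x
    obtain ⟨h1, h2⟩ := automaton_generatesLsd c x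
    obtain ⟨h3, h4⟩ := hM x
    by_cases hx : IsValidZeckendorf x
    · obtain ⟨q, hq, hτ⟩ := h1 hx
      obtain ⟨r, hr, hτ'⟩ := h3 hx
      rw [hq, hr, Option.map_some, Option.map_some, hτ, hτ']
    · rw [h2 hx, h4 hx]; rfl
  have hex : ∀ q : K, ∃ r : Q, ∀ z, (z.foldlM M.δ r).map M.τ = (q.1.behaviour z).map ofBit := by
    intro q
    obtain ⟨x, hx⟩ := hR q.1 q.2
    have h1 := hrun x
    rw [hx, Option.map_some, Option.map_eq_some_iff] at h1
    obtain ⟨r, hr, -⟩ := h1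
    refine ⟨r, fun z => ?_⟩
    have h2 := hrun (x ++ z)
    rw [DFAO.run] at hr hx
    rw [DFAO.run, DFAO.run, List.foldlM_append, List.foldlM_append, hr, hx] at h2
    refine h2.trans ?_
    rw [behaviour, Option.map_map]
    rfl
  choose f hf using hex
  have hinj : Function.Injective f := by
    intro q q' h
    refine Subtype.ext (eq_of_behaviour_eq (hG _ q.2) (hG _ q'.2) (funext fun z => ?_))
    have h1 := hf q z
    rw [h, hf q' z] at h1
    exact (Option.map_injective (fun a b => ofBit_inj.1) h1).symm
  simpa using Fintype.card_le_of_injective f hinj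

lemma isLeast_lsdStateCounts (c : ℕ) (K : Finset ShiftState) (h0 : start c ∈ K)
    (hK : ∀ q ∈ K, ∀ a, q.step a ∈ K) (hR : ∀ q ∈ K, Reachable c q) (hG : ∀ q ∈ K, Good q) :
    IsLeast (lsdStateCounts fun i => fibWord (i + c)) K.card := by
  refine ⟨card_mem_lsdStateCounts c K h0 hK, ?_⟩
  rintro n ⟨Q, _, M, hM, rfl⟩
  exact card_le_of_generatesLsd c K hR hG M hM

/-- Carry indices never grow, because `hofG u ≤ u`; so all states with index at most `c`, together
with the settled ones, form a finite closed set. -/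
lemma lsdStateCounts_nonempty (c : ℕ) :
    (lsdStateCounts fun i => fibWord (i + c)).Nonempty := by
  classical
  let U : Finset (Bool × ℕ × Bool) := Finset.univ ×ˢ Finset.range (c + 1) ×ˢ Finset.univ
  let K : Finset ShiftState := Finset.univ.image (fun p : Bool × Bool => dead p.1 p.2) ∪
    (U.image (fun p => one p.1 p.2.1 p.2.2) ∪ U.image (fun p => two p.1 p.2.1 p.2.2))
  have hdead : ∀ b s, dead b s ∈ K := fun b s => by simp [K]
  have hone : ∀ b u s, one b u s ∈ K ↔ u ≤ c := fun b u s => by simp [K, U]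
  have htwo : ∀ b u s, two b u s ∈ K ↔ u ≤ c := fun b u s => by simp [K, U]
  refine ⟨K.card, card_mem_lsdStateCounts c K ?_ ?_⟩
  · cases c with
    | zero => exact (hone _ _ _).2 le_rfl
    | succ c => exact (htwo _ _ _).2 (Nat.le_succ c)
  · have hle : ∀ u, hofG u ≤ u := hofG_le_self
    rintro (⟨b, s⟩ | ⟨b, _ | u, s⟩ | ⟨b, _ | u, s⟩) hq a
    · exact hdead _ _
    · exact hdead _ _
    · rw [hone] at hq
      have := hle u
      rw [step]
      split_ifs
      · exact (hone _ _ _).2 (by omega)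
      · exact hdead _ _
    · rw [htwo] at hq
      rw [step]
      split_ifs
      · exact hdead _ _
      · exact (hone _ _ _).2 (by omega)
    · rw [htwo] at hq
      have := hle u
      have := hle (u + 1)
      rw [step]
      split_ifs
      · exact (htwo _ _ _).2 (by omega)
      · exact (hone _ _ _).2 (by omega)
      · exact (hone _ _ _).2 (by omega)
      · exact hdead _ _

/-! ### Chains of pending carries and their size -/

/-- The states with one undetermined carry that follow `one b u s`. -/
noncomputable def chain (b : Bool) (u : ℕ) (s : Bool) : Finset ShiftState :=
  match u with
  | 0 => {one b 0 s}
  | u + 1 => insert (one b (u + 1) s) (chain (lowDigit u) (hofG u) (!s))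
termination_by u
decreasing_by exact Nat.lt_succ_of_le (hofG_le_self u)

lemma chain_zero (b s : Bool) : chain b 0 s = {one b 0 s} := by rw [chain]

lemma chain_succ (b : Bool) (u : ℕ) (s : Bool) :
    chain b (u + 1) s = insert (one b (u + 1) s) (chain (lowDigit u) (hofG u) (!s)) := by
  rw [chain]

lemma self_mem_chain (b : Bool) (u : ℕ) (s : Bool) : one b u s ∈ chain b u s := by
  cases u <;> simp [chain_zero, chain_succ]

lemma exists_of_mem_chain {b s : Bool} {u : ℕ} {q : ShiftState} (hg : Good (one b u s))
    (hq : q ∈ chain b u s) : ∃ b' v t, q = one b' v t ∧ v ≤ u ∧ Good q := by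
  induction u using Nat.strong_induction_on generalizing b s with
  | _ u ih =>
    cases u with
    | zero =>
      rw [chain_zero, Finset.mem_singleton] at hq
      exact ⟨b, 0, s, hq, le_rfl, hq ▸ hg⟩
    | succ u =>
      rw [chain_succ, Finset.mem_insert] at hq
      rcases hq with rfl | hq
      · exact ⟨b, u + 1, s, rfl, le_rfl, hg⟩
      · have hu := hofG_le_self u
        obtain ⟨b', v, t, h1, h2, h3⟩ := ih _ (Nat.lt_succ_of_le hu) good_one_step hq
        exact ⟨b', v, t, h1, by omega, h3⟩

lemma step_mem_of_mem_chain {b s : Bool} {u : ℕ} {q : ShiftState}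
    (hq : q ∈ chain b u s) (a : Bool) : q.step a ∈ chain b u s ∨ ∃ t, q.step a = dead a t := by
  induction u using Nat.strong_induction_on generalizing b s with
  | _ u ih =>
    cases u with
    | zero =>
      rw [chain_zero, Finset.mem_singleton] at hq
      subst hq
      exact Or.inr ⟨_, rfl⟩
    | succ u =>
      rw [chain_succ, Finset.mem_insert] at hq
      rcases hq with rfl | hq
      · rw [step]
        split_ifs with ha
        · left
          rw [chain_succ, ha]
          exact Finset.mem_insert_of_mem (self_mem_chain _ _ _)
        · exact Or.inr ⟨_, rfl⟩
      · refine (ih _ (Nat.lt_succ_of_le (hofG_le_self u)) hq).imp_left fun h => ?_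
        rw [chain_succ]
        exact Finset.mem_insert_of_mem h

lemma Reachable.one_step {c u : ℕ} {b s : Bool} (h : Reachable c (one b (u + 1) s))
    (hg : Good (one b (u + 1) s)) : Reachable c (one (lowDigit u) (hofG u) (!s)) := by
  have := h.step (lowDigit u) hg.admissible
  rwa [step_one_digit] at this

lemma Reachable.of_mem_chain {c u : ℕ} {b s : Bool} (h : Reachable c (one b u s))
    (hg : Good (one b u s)) {q : ShiftState} (hq : q ∈ chain b u s) : Reachable c q := by
  induction u using Nat.strong_induction_on generalizing b s with
  | _ u ih =>
    cases u with
    | zero =>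
      rw [chain_zero, Finset.mem_singleton] at hq
      exact hq ▸ h
    | succ u =>
      rw [chain_succ, Finset.mem_insert] at hq
      rcases hq with rfl | hq
      · exact h
      · exact ih _ (Nat.lt_succ_of_le (hofG_le_self u)) (h.one_step hg) good_one_step hq

/-- Two states that arise, after equally many digits, from the two carries of an initial state. -/
structure IsPair (b : Bool) (u : ℕ) (s : Bool) (b' : Bool) (w : ℕ) (s' : Bool) : Prop where
  sign : s' = !s
  adj : w = u ∨ w = u + 1
  good : Good (one b u s)
  good' : Good (one b' w s')
  last : u = 1 → w = 2 → b = false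

lemma hofG_one : hofG 1 = 1 := by simpa using hofG_zshift_succ 0

lemma hofG_two : hofG 2 = 1 := by
  have := hofG_zshift 1
  rwa [zshift, hofG_one] at this

lemma hofG_three : hofG 3 = 2 := by
  have := hofG_zshift 2
  rwa [zshift, hofG_two] at this

lemma lowDigit_eq_false_of_hofG {u w : ℕ} (hw : w = u ∨ w = u + 1) (h1 : hofG u = 1)
    (h2 : hofG w = 2) : lowDigit u = false := by
  by_contra h
  obtain ⟨q, hq, hG, -⟩ := exists_hofG u
  have h' : lowDigit u = true := by simpa using h
  rw [h', Bool.toNat_true] at hq hG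
  have hq0 : q = 0 := by omega
  subst hq0
  simp only [zshift_zero, Nat.zero_add] at hq
  subst hq
  rcases hw with rfl | rfl
  · omega
  · simp [hofG_two] at h2

lemma hofG_adj {u w : ℕ} (h : w = u ∨ w = u + 1) : hofG w = hofG u ∨ hofG w = hofG u + 1 := by
  rcases h with rfl | rfl
  · exact Or.inl rfl
  · exact hofG_succ u

lemma IsPair.succ {b s b' s' : Bool} {u w : ℕ} (h : IsPair b (u + 1) s b' (w + 1) s') :
    IsPair (lowDigit u) (hofG u) (!s) (lowDigit w) (hofG w) (!s') where
  sign := by rw [h.sign]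
  adj := hofG_adj (by have := h.adj; omega)
  good := good_one_step
  good' := good_one_step
  last := lowDigit_eq_false_of_hofG (by have := h.adj; omega)

lemma isPair_of_ne {v : ℕ} (hv : lowDigit v ≠ lowDigit (v + 1)) (s : Bool) :
    IsPair (lowDigit v) (hofG v) (s ^^ lowDigit v) (lowDigit (v + 1)) (hofG (v + 1))
      (s ^^ lowDigit (v + 1)) where
  sign := by
    revert hv
    cases lowDigit v <;> cases lowDigit (v + 1) <;> simp
  adj := hofG_succ v
  good := good_one_step
  good' := good_one_step
  last := lowDigit_eq_false_of_hofG (Or.inr rfl)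

lemma eq_false_of_good_one_zero {b s : Bool} (h : Good (one b 0 s)) : b = false := by
  by_contra hb
  obtain ⟨v, hv, -⟩ := h (by simpa using hb)
  simp at hv

lemma hofG_lt_self {u : ℕ} (h : 2 ≤ u) : hofG u < u := by
  obtain ⟨q, hq, hG, -⟩ := exists_hofG u
  have hq0 : q ≠ 0 := by
    rintro rfl
    have := Bool.toNat_le (lowDigit u)
    simp at hq; omega
  have : hofG 1 ≤ hofG q := hofG_mono (by omega)
  rw [hofG_one] at this
  simp only [zshift] at hq; omega

lemma length_fibRep_one : (fibRep 1).length = 1 := by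
  simpa using @length_fibRep_zshift 0 true (by simp) (by simp)

/-- Each step adds two new states and costs one digit. At the bottom, indices `0, 0` give two states
by opposite parity, while for `0, 1` the longer chain ends in the very state that is the shorter
one, again two in all. -/
lemma IsPair.card_union {b s b' s' : Bool} {u w : ℕ} (h : IsPair b u s b' w s') :
    (chain b u s ∪ chain b' w s').card = 2 * (fibRep (u + 1)).length := by
  induction u using Nat.strong_induction_on generalizing b s b' w s' with
  | _ u ih =>
    have hadj := h.adj
    have hs := h.sign
    subst hs
    cases u with
    | zero =>
      have hb := eq_false_of_good_one_zero h.good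
      subst hb
      rw [length_fibRep_one, chain_zero]
      rcases hadj with rfl | rfl
      · rw [chain_zero]
        have := eq_false_of_good_one_zero h.good'
        subst this
        cases s <;> decide
      · rw [chain_succ, lowDigit_zero, hofG_zero, chain_zero]
        cases s <;> cases b' <;> decide
    | succ u =>
      obtain ⟨w, rfl⟩ : ∃ w', w = w' + 1 := ⟨w - 1, by omega⟩
      have hu := hofG_le_self u
      have hstep := h.succ
      have ih' := ih _ (Nat.lt_succ_of_le hu) hstep
      rw [chain_succ, chain_succ, Finset.insert_union, Finset.union_insert,
        Finset.card_insert_of_notMem, Finset.card_insert_of_notMem, ih', length_fibRep_add_two]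
      · ring
      · intro hmem
        rw [Finset.mem_union] at hmem
        rcases hmem with hmem | hmem
        · obtain ⟨_, v, _, h1, h2, -⟩ := exists_of_mem_chain hstep.good hmem
          injection h1 with _ h1
          omega
        · obtain ⟨_, v, _, h1, h2, -⟩ := exists_of_mem_chain hstep.good' hmem
          injection h1 with _ h1
          have := hofG_le_self w
          omega
      · intro hmem
        rw [Finset.mem_insert, Finset.mem_union] at hmem
        rcases hmem with hmem | hmem | hmem
        · injection hmem with _ _ h3
          simp at h3
        · obtain ⟨_, v, _, h1, h2, -⟩ := exists_of_mem_chain hstep.good hmem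
          injection h1 with _ h1
          omega
        · obtain ⟨_, v, _, h1, h2, -⟩ := exists_of_mem_chain hstep.good' hmem
          injection h1 with _ h1
          -- A state of one chain can recur later in the other only for the indices `1` and `2`;
          -- there the later copy has last digit `1`, which the field `last` of `IsPair` rules out
          -- for the earlier one.
          have hw : w = 1 ∧ u = 0 := by
            have h3 := hofG_le_self w
            by_cases hw2 : 2 ≤ w
            · have := hofG_lt_self hw2
              omega
            · omega
          obtain ⟨rfl, rfl⟩ := hw
          have hb := h.last rfl rfl
          subst hb
          have hd1 : lowDigit 1 = true := by simpa using lowDigit_zshift_succ 0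
          rw [hofG_one, hd1, chain_succ, lowDigit_zero, hofG_zero, chain_zero] at hmem
          simp at hmem

lemma Reachable.dead_of_one_one {c : ℕ} {s : Bool} (h : Reachable c (one false 1 s))
    (b t : Bool) : Reachable c (dead b t) := by
  have key : ∀ t, Reachable c (dead true t) := by
    intro t
    have h1 := h.step true (fun _ => rfl)
    have h2 := (h.step false (by simp)).step true (by simp)
    simp only [ShiftState.step, lowDigit_zero, hofG_zero, reduceIte, Bool.true_eq_false,
      Bool.not_true, Bool.bne_false] at h1 h2
    cases s <;> cases t <;> simp_all
  cases b
  · exact (key t).step false (by simp)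
  · exact key t

/-- Descending both chains ends either in two states of index `0` with opposite parities, or in `one
false 1 _`; both yield all four settled states. The hypothesis `h0` excludes the start where a last
digit `1` would block the digit `1`. -/
lemma IsPair.reachable_dead {c : ℕ} {b s b' s' : Bool} {u w : ℕ} (h : IsPair b u s b' w s')
    (h1 : Reachable c (one b u s)) (h2 : Reachable c (one b' w s'))
    (h0 : u = 0 → w = 1 → b' = false) (a t : Bool) : Reachable c (dead a t) := by
  induction u using Nat.strong_induction_on generalizing b s b' w s' with
  | _ u ih =>
    have hadj := h.adj
    have hs := h.sign
    cases u with
    | zero =>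
      have hb := eq_false_of_good_one_zero h.good
      subst hb
      rcases hadj with rfl | rfl
      · have hb' := eq_false_of_good_one_zero h.good'
        subst hb' hs
        have h3 := h1.step a (fun _ => rfl)
        have h4 := h2.step a (fun _ => rfl)
        simp only [ShiftState.step] at h3 h4
        cases a <;> cases s <;> cases t <;> simp_all
      · have hb' := h0 rfl rfl
        subst hb'
        exact h2.dead_of_one_one a t
    | succ u =>
      obtain ⟨w, rfl⟩ : ∃ w', w = w' + 1 := ⟨w - 1, by omega⟩
      by_cases hc : u = 0 ∧ w = 1
      · obtain ⟨rfl, rfl⟩ := hc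
        have hb := h.last rfl rfl
        subst hb
        exact h1.dead_of_one_one a t
      · refine ih _ (Nat.lt_succ_of_le (hofG_le_self u)) h.succ (h1.one_step h.good)
          (h2.one_step h.good') ?_
        intro h3 h4
        have hu0 : u = 0 := by
          by_contra hu0
          have : hofG 1 ≤ hofG u := hofG_mono (by omega)
          rw [hofG_one] at this; omega
        have hw0 : w = 0 := by omega
        subst hw0
        simp at h4

/-- The four states in which everything is determined. -/
def deads : Finset ShiftState := {dead false false, dead false true, dead true false, dead true true}

lemma mem_deads {q : ShiftState} : q ∈ deads ↔ ∃ b s, q = dead b s := by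
  constructor
  · intro h
    simp only [deads, Finset.mem_insert, Finset.mem_singleton] at h
    rcases h with h | h | h | h <;> exact ⟨_, _, h⟩
  · rintro ⟨b, s, rfl⟩
    cases b <;> cases s <;> decide

/-! ### The exact state count for `c ≥ 5` -/

/-- The states below a state in which two carries have different next digits. -/
noncomputable def below (v : ℕ) (s : Bool) : Finset ShiftState :=
  deads ∪ (chain (lowDigit v) (hofG v) (s ^^ lowDigit v) ∪
    chain (lowDigit (v + 1)) (hofG (v + 1)) (s ^^ lowDigit (v + 1)))

lemma mem_below {v : ℕ} {s : Bool} {q : ShiftState} (h : q ∈ below v s) :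
    q ∈ deads ∨ ∃ d u t, q ∈ chain d u t ∧ Good (one d u t) ∧ chain d u t ⊆ below v s ∧
      (d = lowDigit v ∧ u = hofG v ∨ d = lowDigit (v + 1) ∧ u = hofG (v + 1)) ∧
      t = (s ^^ d) := by
  rw [below, Finset.mem_union, Finset.mem_union] at h
  rcases h with h | h | h
  · exact Or.inl h
  · exact Or.inr ⟨_, _, _, h, good_one_step, fun x hx => by simp [below, hx], Or.inl ⟨rfl, rfl⟩, rfl⟩
  · exact Or.inr ⟨_, _, _, h, good_one_step, fun x hx => by simp [below, hx], Or.inr ⟨rfl, rfl⟩, rfl⟩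

lemma dead_mem_below (v : ℕ) (s b t : Bool) : dead b t ∈ below v s :=
  Finset.mem_union_left _ (mem_deads.2 ⟨b, t, rfl⟩)

lemma good_of_mem_below {v : ℕ} {s : Bool} {q : ShiftState} (h : q ∈ below v s) : Good q := by
  rcases mem_below h with h | ⟨d, u, t, h1, h2, -⟩
  · obtain ⟨b, s, rfl⟩ := mem_deads.1 h
    trivial
  · obtain ⟨_, _, _, -, -, h3⟩ := exists_of_mem_chain h2 h1
    exact h3

lemma two_notMem_below (v : ℕ) (s b : Bool) (u : ℕ) (t : Bool) : two b u t ∉ below v s := by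
  intro h
  rcases mem_below h with h | ⟨d, u', t', h1, h2, -⟩
  · obtain ⟨b, s, h⟩ := mem_deads.1 h
    cases h
  · obtain ⟨_, _, _, h3, -⟩ := exists_of_mem_chain h2 h1
    cases h3

lemma step_mem_below {v : ℕ} {s : Bool} {q : ShiftState} (h : q ∈ below v s) (a : Bool) :
    q.step a ∈ below v s := by
  rcases mem_below h with h | ⟨d, u, t, h1, -, h3, -⟩
  · obtain ⟨b, t, rfl⟩ := mem_deads.1 h
    exact dead_mem_below _ _ _ _
  · rcases step_mem_of_mem_chain h1 a with h4 | ⟨t', h4⟩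
    · exact h3 h4
    · rw [h4]; exact dead_mem_below _ _ _ _

lemma step_two_mem_below {v : ℕ} (hv : lowDigit v ≠ lowDigit (v + 1)) (b s a : Bool) :
    (two b (v + 1) s).step a ∈ below v s := by
  obtain ⟨u, hu, -, h1, h2⟩ := step_two_of_ne hv b s a
  rw [hu, below, Finset.mem_union, Finset.mem_union]
  right
  by_cases ha : a = lowDigit v
  · left; rw [h1 ha, ← ha]; exact self_mem_chain _ _ _
  · have ha' : a = lowDigit (v + 1) := by
      cases h1 : lowDigit v <;> cases h2 : lowDigit (v + 1) <;> simp_all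
    right; rw [h2 ha', ← ha']; exact self_mem_chain _ _ _

lemma card_below {v : ℕ} (hv : lowDigit v ≠ lowDigit (v + 1)) (s : Bool) :
    (below v s).card + 2 = 4 + 2 * (fibRep (v + 2)).length := by
  have hp := isPair_of_ne hv s
  rw [below, Finset.card_union_of_disjoint, hp.card_union, length_fibRep_add_two]
  · simp [deads]; ring
  · rw [Finset.disjoint_left]
    intro q h1 h2
    obtain ⟨b, t, rfl⟩ := mem_deads.1 h1
    rcases Finset.mem_union.1 h2 with h2 | h2
    · obtain ⟨_, _, _, h3, -⟩ := exists_of_mem_chain hp.good h2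
      cases h3
    · obtain ⟨_, _, _, h3, -⟩ := exists_of_mem_chain hp.good' h2
      cases h3

lemma Reachable.below {c v : ℕ} {s : Bool} (hv : lowDigit v ≠ lowDigit (v + 1))
    (hv0 : hofG v ≠ 0) (h : Reachable c (two false (v + 1) s)) {q : ShiftState}
    (hq : q ∈ below v s) : Reachable c q := by
  have hp := isPair_of_ne hv s
  have hr1 : Reachable c (one (lowDigit v) (hofG v) (s ^^ lowDigit v)) := by
    have := h.step (lowDigit v) (fun _ => rfl)
    obtain ⟨u, hu, -, h1, -⟩ := step_two_of_ne hv false s (lowDigit v)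
    rwa [hu, h1 rfl] at this
  have hr2 : Reachable c (one (lowDigit (v + 1)) (hofG (v + 1)) (s ^^ lowDigit (v + 1))) := by
    have := h.step (lowDigit (v + 1)) (fun _ => rfl)
    obtain ⟨u, hu, -, -, h1⟩ := step_two_of_ne hv false s (lowDigit (v + 1))
    rwa [hu, h1 rfl] at this
  rcases mem_below hq with hq | ⟨d, u, t, h1, h2, -, h3, h4⟩
  · obtain ⟨b, t, rfl⟩ := mem_deads.1 hq
    exact hp.reachable_dead hr1 hr2 (fun h => absurd h hv0) b t
  · refine Reachable.of_mem_chain ?_ h2 h1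
    rw [h4]
    rcases h3 with ⟨rfl, rfl⟩ | ⟨rfl, rfl⟩
    · exact hr1
    · exact hr2

lemma gCorr_eq (v : ℕ) :
    gCorr (v + 2) = if lowDigit v = lowDigit (v + 1) then 1 else 0 := by
  have h := @lowDigit_succ_of_true v
  rw [gCorr]
  simp only [Nat.add_sub_cancel, show v + 2 - 1 = v + 1 by omega, fibWord_eq]
  cases h1 : lowDigit v <;> cases h2 : lowDigit (v + 1) <;> simp_all [ofBit]

theorem isLeast_lsdStateCounts_fibWord {c : ℕ} (hc : 5 ≤ c) :
    IsLeast (lsdStateCounts fun i => fibWord (i + c))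
      (2 * ((fibRep c).length + 1) + 1 - gCorr c) := by
  obtain ⟨v, rfl⟩ : ∃ v, c = v + 2 := ⟨c - 2, by omega⟩
  -- The bound `c ≥ 5` enters here: it keeps the pair below away from index `0`, even after the
  -- extra step of the case with equal digits, so that all four settled states are reachable.
  have hG3 : 2 ≤ hofG v := by
    rw [← hofG_three]
    exact hofG_mono (by omega)
  have hstart : start (v + 2) = two false (v + 1) (lowDigit (v + 1)) := rfl
  have hreach := reachable_start (v + 2)
  rw [hstart] at hreach
  set s := lowDigit (v + 1)
  rw [gCorr_eq]
  by_cases hv : lowDigit v = lowDigit (v + 1)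
  · obtain ⟨h1, h2, w, hw, hne⟩ := step_two_of_eq hv false s
    have hcard := card_below hne s
    have hlen := length_fibRep_add_two v
    rw [hw] at h1 hlen
    have hw0 : hofG w ≠ 0 := by
      have : hofG 1 ≤ hofG w := hofG_mono (by omega)
      rw [hofG_one] at this; omega
    have hvw : v ≠ w := by
      have := hofG_le_self v
      omega
    have hreach1 : Reachable (v + 2) (two false (w + 1) s) := h1 ▸ hreach.step false (by simp)
    have hK : (insert (two false (v + 1) s) (insert (two false (w + 1) s) (below w s))).card =
        2 * ((fibRep (v + 2)).length + 1) + 1 - 1 := by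
      rw [Finset.card_insert_of_notMem, Finset.card_insert_of_notMem (two_notMem_below _ _ _ _ _)]
      · rw [show w + 1 + 1 = w + 2 from rfl] at hlen; omega
      · rw [Finset.mem_insert, not_or]
        refine ⟨fun h => ?_, two_notMem_below _ _ _ _ _⟩
        injection h with _ h
        omega
    rw [if_pos hv, ← hK]
    refine isLeast_lsdStateCounts _ _ (by rw [hstart]; simp) ?_ ?_ ?_
    · intro q hq a
      simp only [Finset.mem_insert] at hq ⊢
      rcases hq with rfl | rfl | hq
      · cases a
        · exact Or.inr (Or.inl h1)
        · rw [h2]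
          exact Or.inr (Or.inr (dead_mem_below _ _ _ _))
      · exact Or.inr (Or.inr (step_two_mem_below hne _ _ _))
      · exact Or.inr (Or.inr (step_mem_below hq a))
    · intro q hq
      simp only [Finset.mem_insert] at hq
      rcases hq with rfl | rfl | hq
      · exact hreach
      · exact hreach1
      · exact hreach1.below hne hw0 hq
    · intro q hq
      simp only [Finset.mem_insert] at hq
      rcases hq with rfl | rfl | hq
      · exact ⟨rfl, Nat.succ_ne_zero _⟩
      · exact ⟨rfl, Nat.succ_ne_zero _⟩
      · exact good_of_mem_below hq
  · have hcard := card_below hv s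
    have hK : (insert (two false (v + 1) s) (below v s)).card =
        2 * ((fibRep (v + 2)).length + 1) + 1 - 0 := by
      rw [Finset.card_insert_of_notMem (two_notMem_below _ _ _ _ _)]
      omega
    rw [if_neg hv, ← hK]
    refine isLeast_lsdStateCounts _ _ (by rw [hstart]; simp) ?_ ?_ ?_
    · intro q hq a
      simp only [Finset.mem_insert] at hq ⊢
      rcases hq with rfl | hq
      · exact Or.inr (step_two_mem_below hv _ _ _)
      · exact Or.inr (step_mem_below hq a)
    · intro q hq
      simp only [Finset.mem_insert] at hq
      rcases hq with rfl | hq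
      · exact hreach
      · exact hreach.below hv (by omega) hq
    · intro q hq
      simp only [Finset.mem_insert] at hq
      rcases hq with rfl | hq
      · exact ⟨rfl, Nat.succ_ne_zero _⟩
      · exact good_of_mem_below hq

end ShiftState

/-! ### Fibonacci-regularity -/

lemma zshift_mono : Monotone zshift := fun _ _ h => Nat.add_le_add h (hofG_mono h)

/-- Induction along the canonical representation. -/
lemma zshift_induction {P : ℕ → Prop} (h0 : P 0)
    (hs : ∀ m (a : Bool), (a = true → lowDigit m = false) → 0 < zshift m + a.toNat → P m →
      P (zshift m + a.toNat)) (n : ℕ) : P n := by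
  induction n using Nat.strong_induction_on with
  | _ n ih =>
    rcases Nat.eq_zero_or_pos n with rfl | hn
    · exact h0
    obtain ⟨m, hm, ha⟩ := exists_zshift n
    have hlt : m < n := by
      by_cases h : m = 0
      · omega
      · have : hofG 1 ≤ hofG m := hofG_mono (by omega)
        rw [ShiftState.hofG_one] at this
        simp only [zshift] at hm; omega
    have := hs m (lowDigit n) ha (by omega) (ih m hlt)
    rwa [← hm] at this

/-- A sequence that is a linear function of a vector which evolves linearly with the Zeckendorf
digits is Fibonacci-regular. -/
lemma isFibonacciRegular_of_vecMul {ι R : Type*} [Fintype ι] [DecidableEq ι] [Semiring R]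
    {s : ℕ → R} (u : ℕ → ι → R) (γ : Fin 2 → Matrix ι ι R) (w : ι → R)
    (hu : ∀ m (a : Bool), (a = true → lowDigit m = false) → 0 < zshift m + a.toNat →
      u (zshift m + a.toNat) = u m ᵥ* γ (ofBit a))
    (hs : ∀ n, s n = u n ⬝ᵥ w) : IsFibonacciRegular s := by
  let e := Fintype.equivFin ι
  refine ⟨Fintype.card ι, u 0 ∘ e.symm, fun a => (γ a).submatrix e.symm e.symm, w ∘ e.symm,
    fun n => ?_⟩
  have key : ∀ n, u n ∘ e.symm =
      (u 0 ∘ e.symm) ᵥ* ((fibRep n).map fun a => (γ a).submatrix e.symm e.symm).prod := by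
    intro n
    induction n using zshift_induction with
    | h0 => simp
    | hs m a ha h0 ih =>
      rw [fibRep_zshift ha h0, List.map_append, List.prod_append, ← Matrix.vecMul_vecMul, ← ih,
        hu m a ha h0]
      simp [Matrix.submatrix_vecMul_equiv, Function.comp_assoc]
  rw [Matrix.dotProduct_mulVec, ← key, hs]
  simp [Function.comp_assoc]

/-- A finite automaton reading Zeckendorf representations together with a counter computes a
Fibonacci-regular sequence. -/
lemma isFibonacciRegular_of_counter {Q : Type*} [Fintype Q] [DecidableEq Q] {s : ℕ → ℕ}
    (σ : ℕ → Q) (δ : Q → Bool → Q) (inc : Q → ℕ) (cnt : ℕ → ℕ) (h : Q → ℕ)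
    (hσ : ∀ m (a : Bool), (a = true → lowDigit m = false) → 0 < zshift m + a.toNat →
      σ (zshift m + a.toNat) = δ (σ m) a ∧ cnt (zshift m + a.toNat) = cnt m + inc (σ m))
    (hs : ∀ n, s n = h (σ n) + 2 * cnt n) : IsFibonacciRegular s := by
  -- The row vector is the indicator of the current state together with the counter; the
  -- off-diagonal block adds the increment of that state.
  refine isFibonacciRegular_of_vecMul (ι := Q ⊕ Unit)
    (fun n => Sum.elim (Pi.single (σ n) 1) fun _ => cnt n)
    (fun a => Matrix.fromBlocks (Matrix.of fun q q' => if δ q (bit a) = q' then 1 else 0)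
      (Matrix.of fun q _ => inc q) 0 1)
    (Sum.elim h fun _ => 2) ?_ ?_
  · intro m a ha h0
    obtain ⟨h1, h2⟩ := hσ m a ha h0
    rw [Matrix.vecMul_fromBlocks, h1, h2]
    simp only [Matrix.vecMul_zero, Matrix.vecMul_one]
    ext (q | q)
    · simp [Pi.single_apply, Matrix.row, eq_comm]
    · simp [Matrix.row, Nat.add_comm]
  · intro n
    rw [hs, sumElim_dotProduct_sumElim]
    simp [Nat.mul_comm]

lemma fibRep_length_mono : Monotone fun n => (fibRep n).length := fun a b h => by
  simp only [length_fibRep]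
  have := Nat.greatestFib_mono h
  omega

lemma length_fibRep_three : (fibRep 3).length = 3 := by
  have h : Nat.greatestFib 3 = 4 := Nat.greatestFib_fib (n := 4) (by norm_num)
  rw [length_fibRep, h]

lemma length_fibRep_four : (fibRep 4).length = 3 := by
  have h1 : Nat.greatestFib 4 < 5 := by rw [Nat.greatestFib_lt]; decide
  have h2 : 4 ≤ Nat.greatestFib 4 := by rw [Nat.le_greatestFib]; decide
  rw [length_fibRep]; omega

lemma length_fibRep_five : (fibRep 5).length = 4 := by
  have h : Nat.greatestFib 5 = 5 := Nat.greatestFib_fib (n := 5) (by norm_num)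
  rw [length_fibRep, h]

/-- The correction term for the numbers `≥ 5`. -/
noncomputable def correction (n : ℕ) : Bool := decide (5 ≤ n ∧ gCorr n = 1)

lemma correction_toNat {n : ℕ} (hn : 5 ≤ n) : (correction n).toNat = gCorr n := by
  unfold correction gCorr
  split_ifs <;> simp [hn]

/-- This makes the correction computable msd first: it depends only on the appended digit and on the
low digit of `m - 1`, which itself evolves by `lowDigit_zshift_pred`. -/
lemma gCorr_zshift {m : ℕ} {a : Bool} (ha : a = true → lowDigit m = false)
    (h : 5 ≤ zshift m + a.toNat) :
    gCorr (zshift m + a.toNat) = 1 ↔ a = true ∧ lowDigit (m - 1) = true := by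
  have hm0 : m ≠ 0 := by
    rintro rfl
    have := Bool.toNat_le a
    simp at h; omega
  obtain ⟨k, rfl⟩ := Nat.exists_eq_succ_of_ne_zero hm0
  rw [Nat.succ_eq_add_one] at *
  have hp := @lowDigit_zshift_pred k
  obtain ⟨v, hv⟩ : ∃ v, zshift (k + 1) + a.toNat = v + 2 := ⟨_, (Nat.sub_add_cancel (by omega)).symm⟩
  rw [hv, ShiftState.gCorr_eq]
  simp only [Nat.add_sub_cancel]
  cases a
  · simp only [Bool.toNat_false, Nat.add_zero, Bool.false_eq_true, false_and, iff_false] at hv ⊢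
    rw [hv, show v + 2 - 1 = v + 1 by omega] at hp
    have h11 := @lowDigit_succ_of_true v
    cases hk : lowDigit k
    · rw [hk] at hp
      cases hd : lowDigit v <;> simp_all
    · have h5 := zshift_succ k
      have hk0 : k ≠ 0 := by rintro rfl; simp at hk
      obtain ⟨j, rfl⟩ := Nat.exists_eq_succ_of_ne_zero hk0
      have h7 := @lowDigit_zshift_pred j
      rw [Nat.succ_eq_add_one] at *
      rw [hk, hv] at h5
      rw [show zshift (j + 1) - 1 = v by simp at h5; omega] at h7
      have h8 : lowDigit j = false := by
        by_contra hj
        rw [lowDigit_succ_of_true (by simpa using hj)] at hk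
        simp at hk
      simp [h7, h8, hp, hk]
  · simp only [Bool.toNat_true] at hv
    have h1 : zshift (k + 1) = v + 1 := by omega
    have h2 : lowDigit (v + 1) = false := by rw [← h1]; simp
    rw [h1, Nat.add_sub_cancel] at hp
    rw [h2, hp]
    cases lowDigit k <;> simp

/-- The number of digits beyond the fourth one. -/
noncomputable def excess (n : ℕ) : ℕ := if n < 5 then 0 else (fibRep n).length - 4

lemma excess_zshift {m : ℕ} {a : Bool} (ha : a = true → lowDigit m = false)
    (h0 : 0 < zshift m + a.toNat) :
    excess (zshift m + a.toNat) = excess m + if m < 5 then 0 else 1 := by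
  have hlen := length_fibRep_zshift ha h0
  have h2 := Bool.toNat_le a
  unfold excess
  rw [hlen]
  by_cases hm : m < 5
  · rw [if_pos hm, if_pos hm]
    split_ifs with h1
    · rfl
    · have hm3 : m = 3 ∨ m = 4 := by
        by_contra hne
        have h4 : zshift m ≤ zshift 2 := zshift_mono (by omega)
        simp only [zshift, ShiftState.hofG_two] at h4 h1
        omega
      rcases hm3 with rfl | rfl
      · rw [length_fibRep_three]
      · rw [length_fibRep_four]
  · have h5 : 4 ≤ (fibRep m).length := by
      rw [← length_fibRep_five]; exact fibRep_length_mono (by omega)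
    have h6 : ¬ zshift m + a.toNat < 5 := by simp only [zshift]; omega
    rw [if_neg hm, if_neg h6, if_neg hm]
    omega

lemma min_zshift (m : ℕ) (a : Bool) :
    min (zshift m + a.toNat) 5 = min (zshift (min m 5) + a.toNat) 5 := by
  rcases le_total m 5 with h | h
  · rw [min_eq_left h]
  · rw [min_eq_right h, min_eq_right, min_eq_right] <;> simp only [zshift] <;> omega

lemma lsdStateComplexity_eq {c : ℕ} (hc : 5 ≤ c) :
    (lsdStateComplexity fun i => fibWord (i + c)) = 2 * ((fibRep c).length + 1) + 1 - gCorr c :=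
  (ShiftState.isLeast_lsdStateCounts_fibWord hc).csInf_eq

lemma isFibonacciRegular_lsdStateComplexity :
    IsFibonacciRegular fun c : ℕ => lsdStateComplexity fun i => fibWord (i + c) := by
  -- The state stores the value truncated at `5`, the low digit of the predecessor and the
  -- correction. The constant `11` is `2 * (4 + 1) + 1`, the formula at length four, where the
  -- counter `excess` is zero.
  refine isFibonacciRegular_of_counter (Q := Fin 6 × Bool × Bool)
    (fun n => (⟨min n 5, by omega⟩, lowDigit (n - 1), correction n))
    (fun q a => (⟨min (zshift q.1 + a.toNat) 5, by omega⟩, !a && !q.2.1,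
      decide (5 ≤ zshift q.1 + a.toNat) && (a && q.2.1)))
    (fun q => if q.1.val < 5 then 0 else 1) excess
    (fun q => if q.1.val < 5 then lsdStateComplexity fun i => fibWord (i + q.1.val)
      else 11 - q.2.2.toNat) ?_ ?_
  · intro m a ha h0
    have h5 : 5 ≤ zshift (min m 5) + a.toNat ↔ 5 ≤ zshift m + a.toNat := by
      have := min_zshift m a
      omega
    refine ⟨?_, ?_⟩
    · simp only [Prod.mk.injEq, Fin.mk.injEq]
      refine ⟨min_zshift m a, ?_, ?_⟩
      · cases a
        · have hm0 : m ≠ 0 := by rintro rfl; simp at h0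
          obtain ⟨k, rfl⟩ := Nat.exists_eq_succ_of_ne_zero hm0
          simpa using @lowDigit_zshift_pred k
        · simp
      · unfold correction
        rw [Bool.eq_iff_iff]
        simp only [decide_eq_true_eq, Bool.and_eq_true, h5]
        exact and_congr_right fun h => gCorr_zshift ha h
    · rw [excess_zshift ha h0]
      simp only [min_lt_iff, lt_irrefl, or_false]
  · intro n
    simp only [min_lt_iff, lt_irrefl, or_false, excess]
    split_ifs with h
    · rw [min_eq_left h.le, Nat.mul_zero, Nat.add_zero]
    · have hn : 5 ≤ n := by omega
      have h5 : 4 ≤ (fibRep n).length := by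
        rw [← length_fibRep_five]; exact fibRep_length_mono hn
      have := Bool.toNat_le (correction n)
      rw [lsdStateComplexity_eq hn, ← correction_toNat hn]
      omega

/-! ### Logarithmic growth -/

lemma three_halves_pow_le_fib (n : ℕ) : (3 / 2 : ℝ) ^ n ≤ Nat.fib (n + 2) := by
  induction n using Nat.twoStepInduction with
  | zero => norm_num
  | one => norm_num [Nat.fib]
  | more n h1 h2 =>
    rw [Nat.fib_add_two (n := n + 2)]
    push_cast
    have : (3 / 2 : ℝ) ^ (n + 2) ≤ (3 / 2 : ℝ) ^ n + (3 / 2 : ℝ) ^ (n + 1) := by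
      have : (0 : ℝ) < (3 / 2 : ℝ) ^ n := by positivity
      rw [pow_succ, pow_succ]
      nlinarith
    rw [show n + 2 + 1 = n + 1 + 2 by omega]
    linarith

lemma fib_le_two_pow (n : ℕ) : Nat.fib n ≤ 2 ^ n := by
  induction n using Nat.twoStepInduction with
  | zero => simp
  | one => simp
  | more n h1 h2 =>
    rw [Nat.fib_add_two]
    have : 2 ^ (n + 2) = 2 * 2 ^ (n + 1) := by ring
    have : 2 ^ (n + 1) = 2 * 2 ^ n := by ring
    omega

/-- The logarithm is comparable to the length of the Zeckendorf representation. -/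
lemma log_bounds {c : ℕ} (hc : 5 ≤ c) :
    ((fibRep c).length : ℝ) * Real.log (3 / 2) ≤ 2 * Real.log c ∧
      Real.log c ≤ 2 * (fibRep c).length * Real.log 2 := by
  have hc0 : (0 : ℝ) < c := by positivity
  have h4 : 4 ≤ (fibRep c).length := by
    rw [← length_fibRep_five]; exact fibRep_length_mono hc
  obtain ⟨k, hk⟩ : ∃ k, (fibRep c).length = k + 1 := ⟨_, (Nat.sub_add_cancel (by omega)).symm⟩
  have hg : c.greatestFib = k + 2 := by rw [length_fibRep] at hk; omega
  have h1 : Nat.fib (k + 2) ≤ c := hg ▸ c.fib_greatestFib_le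
  have h2 : c < Nat.fib (k + 3) := by
    have := c.lt_fib_greatestFib_add_one
    rwa [hg] at this
  have hk3 : (3 : ℝ) ≤ k := by exact_mod_cast (by omega : 3 ≤ k)
  rw [hk]
  push_cast
  constructor
  · have h3 : (3 / 2 : ℝ) ^ k ≤ c := (three_halves_pow_le_fib k).trans (by exact_mod_cast h1)
    have h5 := Real.log_le_log (by positivity) h3
    rw [Real.log_pow] at h5
    have : 0 < Real.log (3 / 2) := Real.log_pos (by norm_num)
    nlinarith
  · have h3 : (c : ℝ) ≤ (2 : ℝ) ^ (k + 3) := by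
      exact_mod_cast h2.le.trans (fib_le_two_pow _)
    have h5 := Real.log_le_log hc0 h3
    rw [Real.log_pow] at h5
    push_cast at h5
    have : 0 < Real.log 2 := Real.log_pos (by norm_num)
    nlinarith

lemma isTheta_lsdStateComplexity :
    (fun c : ℕ => (lsdStateComplexity fun i => fibWord (i + c) : ℝ)) =Θ[atTop]
      (fun c : ℕ => Real.log c) := by
  have hbd : ∀ c : ℕ, 5 ≤ c → (2 * (fibRep c).length : ℝ) ≤
      (lsdStateComplexity fun i => fibWord (i + c) : ℝ) ∧
      (lsdStateComplexity fun i => fibWord (i + c) : ℝ) ≤ 5 * (fibRep c).length := by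
    intro c hc
    have h4 : 4 ≤ (fibRep c).length := by
      rw [← length_fibRep_five]; exact fibRep_length_mono hc
    have hg : gCorr c ≤ 1 := by unfold gCorr; split_ifs <;> simp
    rw [lsdStateComplexity_eq hc]
    constructor <;> exact_mod_cast (by omega)
  have hl1 : 0 < Real.log (3 / 2) := Real.log_pos (by norm_num)
  have hl2 : 0 < Real.log 2 := Real.log_pos (by norm_num)
  constructor
  -- The constant is the product of the `5` in `hbd` and the factor `2 / log (3/2)` in `log_bounds`.
  · refine IsBigO.of_bound (10 / Real.log (3 / 2)) ?_
    filter_upwards [eventually_ge_atTop 5] with c hc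
    have h1 := (log_bounds hc).1
    have h2 := (hbd c hc).2
    have h0 : 0 ≤ Real.log c := Real.log_natCast_nonneg c
    rw [Real.norm_of_nonneg h0, Real.norm_of_nonneg (Nat.cast_nonneg _), div_mul_eq_mul_div,
      le_div_iff₀ hl1]
    nlinarith
  · refine IsBigO.of_bound (Real.log 2) ?_
    filter_upwards [eventually_ge_atTop 5] with c hc
    have h1 := (log_bounds hc).2
    have h2 := (hbd c hc).1
    have h0 : 0 ≤ Real.log c := Real.log_natCast_nonneg c
    rw [Real.norm_of_nonneg h0, Real.norm_of_nonneg (Nat.cast_nonneg _)]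
    nlinarith

theorem theorem2 :
    (∀ c : ℕ, 5 ≤ c →
      IsLeast (lsdStateCounts fun i => fibWord (i + c))
        (2 * ((fibRep c).length + 1) + 1 - gCorr c)) ∧
    (∀ c : ℕ, (lsdStateCounts fun i => fibWord (i + c)).Nonempty) ∧
    IsFibonacciRegular (fun c : ℕ => lsdStateComplexity fun i => fibWord (i + c)) ∧
    (fun c : ℕ => (lsdStateComplexity fun i => fibWord (i + c) : ℝ)) =Θ[atTop]
      (fun c : ℕ => Real.log c) :=
  ⟨fun _ hc => ShiftState.isLeast_lsdStateCounts_fibWord hc, ShiftState.lsdStateCounts_nonempty,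
    isFibonacciRegular_lsdStateComplexity, isTheta_lsdStateComplexity⟩
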